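/- Let $X$ be a compact Hausdorff space and let $C(X)$ be the algebra of continuous complex-valued functions on $X$ with the supremum norm. A uniform algebra on $X$ is a closed subalgebra $A$ of $C(X)$ that contains the constants and separates the points of $X$. It is normal if every nonzero multiplicative linear functional on $A$ is evaluation at a point of $X$ and, for each pair of disjoint closed sets $K_0,K_1\subset X$, there is $f\in A$ with $f=1$ on $K_1$ and $f=0$ on $K_0$. For $x\in X$ let $M_x=\{f\in A: f(x)=0\}$ and let $J_x$ be the set of $f\in A$ that vanish on a neighborhood of $x$; $A$ is strongly regular at $x$ if $\overline{J_x}=M_x$. The point $x$ is a peak point for $A$ if there is $f\in A$ with $f(x)=1$ and $|f(y)|<1$ for every $y\in X\setminus\{x\}$. For a compact set $K\subset\mathbb{C}$, $R(K)$ denotes the uniform closure in $C(K)$ of the rational functions with poles off $K$. Theorem. There exists a normal uniform algebra $A$, on a compact metrizable space, such that $A$ fails to be strongly regular at some peak point for $A$. In fact, $A$ can be taken to be $R(K)$ for a certain compact set $K$ in the complex plane. -/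

import Mathlib

open Polynomial Topology

/-! Uniform algebras. For a compact space `X`, the topology of `C(X, ℂ)` is the one given by the
supremum norm. -/

namespace UniformAlgebra

/-- A subalgebra of `C(X, ℂ)` (it contains the constants, being unital) is a uniform algebra on the
compact Hausdorff space `X` if it is closed and separates the points of `X`. -/
structure IsUniformAlgebra {X : Type*} [TopologicalSpace X] [CompactSpace X] [T2Space X]
    (A : Subalgebra ℂ C(X, ℂ)) : Prop where
  isClosed : IsClosed (A : Set C(X, ℂ))
  separatesPoints : A.SeparatesPoints

/-- The (nonzero) multiplicative linear functional `f ↦ f x` on `A`. -/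
noncomputable def evalAt {X : Type*} [TopologicalSpace X] (A : Subalgebra ℂ C(X, ℂ)) (x : X) : A →ₐ[ℂ] ℂ :=
  (ContinuousMap.evalAlgHom ℂ ℂ x).comp A.val

/-- `A` is natural: point evaluation identifies `X` with the set of all nonzero multiplicative
linear functionals on `A`. -/
def IsNatural {X : Type*} [TopologicalSpace X] (A : Subalgebra ℂ C(X, ℂ)) : Prop :=
  Function.Bijective (evalAt A)

/-- `A` is normal on `X`: disjoint closed sets are separated by functions in `A`. -/
def IsNormalOn {X : Type*} [TopologicalSpace X] (A : Subalgebra ℂ C(X, ℂ)) : Prop :=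
  ∀ K₀ K₁ : Set X, IsClosed K₀ → IsClosed K₁ → Disjoint K₀ K₁ →
    ∃ f ∈ A, (∀ x ∈ K₁, f x = 1) ∧ ∀ x ∈ K₀, f x = 0

/-- `A` is normal: it is natural, and normal on `X`. -/
def IsNormal {X : Type*} [TopologicalSpace X] (A : Subalgebra ℂ C(X, ℂ)) : Prop :=
  IsNatural A ∧ IsNormalOn A

/-- `M_x`, the ideal of the functions in `A` that vanish at `x`. -/
def idealM {X : Type*} [TopologicalSpace X] (A : Subalgebra ℂ C(X, ℂ)) (x : X) : Ideal A where
  carrier := {f | (f : C(X, ℂ)) x = 0}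
  zero_mem' := by simp
  add_mem' := by
    intro f g hf hg
    simp_all
  smul_mem' := by
    intro c f hf
    simp_all

/-- `J_x`, the ideal of the functions in `A` whose zero set contains a neighbourhood of `x`. -/
def idealJ {X : Type*} [TopologicalSpace X] (A : Subalgebra ℂ C(X, ℂ)) (x : X) : Ideal A where
  carrier := {f | {y | (f : C(X, ℂ)) y = 0} ∈ 𝓝 x}
  zero_mem' := by simp
  add_mem' := by
    intro f g hf hg
    filter_upwards [hf, hg] with y hy hy'
    simp_all
  smul_mem' := by
    intro c f hf
    filter_upwards [hf] with y hy
    simp_all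

/-- `A` is strongly regular at `x`: the closure of `J_x` is `M_x`. -/
def IsStronglyRegularAt {X : Type*} [TopologicalSpace X] (A : Subalgebra ℂ C(X, ℂ)) (x : X) :
    Prop :=
  closure (idealJ A x : Set A) = (idealM A x : Set A)

/-- `x` is a peak point for `A`. -/
def IsPeakPoint {X : Type*} [TopologicalSpace X] (A : Subalgebra ℂ C(X, ℂ)) (x : X) : Prop :=
  ∃ f ∈ A, f x = 1 ∧ ∀ y, y ≠ x → ‖f y‖ < 1

/-- The algebra of (restrictions to `K` of) rational functions with poles off `K`. -/
def ratFunctions (K : TopologicalSpace.Compacts ℂ) : Subalgebra ℂ C(K, ℂ) where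
  carrier := {f | ∃ p q : ℂ[X], (∀ z ∈ K, q.eval z ≠ 0) ∧
    ∀ z : K, f z = p.eval (z : ℂ) / q.eval (z : ℂ)}
  mul_mem' := by
    rintro f g ⟨p, q, hq, hf⟩ ⟨p', q', hq', hg⟩
    refine ⟨p * p', q * q', fun z hz => ?_, fun z => ?_⟩
    · simpa using ⟨hq z hz, hq' z hz⟩
    · simp [hf, hg, div_mul_div_comm]
  add_mem' := by
    rintro f g ⟨p, q, hq, hf⟩ ⟨p', q', hq', hg⟩
    refine ⟨p * q' + q * p', q * q', fun z hz => ?_, fun z => ?_⟩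
    · simpa using ⟨hq z hz, hq' z hz⟩
    · simp [hf, hg, div_add_div _ _ (hq z z.2) (hq' z z.2)]
  algebraMap_mem' := by
    intro c
    exact ⟨C c, 1, by simp, by simp⟩

/-- `R(K)`, the uniform closure on `K` of the rational functions with poles off `K`. -/
noncomputable def R (K : TopologicalSpace.Compacts ℂ) : Subalgebra ℂ C(K, ℂ) :=
  (ratFunctions K).topologicalClosure

end UniformAlgebra

/-! The set `K` is a closed sector with vertex at `0` from which countably many small discs are
removed. Since the sector lies in the right half plane, `1 - z / 10` peaks at the vertex.

Normality comes from McKissick's discs (`exists_mckissick_discs`). Inside an annulus one can remove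
discs of arbitrarily small total radius so that an infinite product of the rational functions `1 /
(1 - ((z - c) / ρ) ^ m)` converges on what remains, vanishes outside the annulus and is nonzero
inside it. Doing this for countably many annuli separates points from closed sets; as every
character of `R K` is a point evaluation (`isNatural_R`), an ideal argument
(`isNormalOn_of_regular`) upgrades this to normality.

Strong regularity is obstructed by pairing with `G * dbar ψ`, where `G = exp (1 / z²)` and `ψ` is a
cutoff to the sector minus finitely many discs. `G` is tiny near the two sides of the sector and
huge along its axis. The removed discs are so small, relative to the size of `G` on them, that the
densities `G * dbar ψ` are bounded in `L¹` uniformly in the number of discs. By Cauchy's theorem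
they annihilate functions that are holomorphic near the truncated set and vanish near `0`, and they
nearly annihilate rational functions that are very small near `0`. Yet on `z / (z - a)`, whose pole
lies in a removed disc on the axis, the pairing has a value that does not depend on the other discs:
a bounded term minus a nonzero multiple of `a * G a`, hence nonzero for small `a`
(`exists_pairing_ne_zero`). So `z / (z - a)`, which vanishes at `0`, is not a limit of functions
vanishing near `0` (`norm_pairing_le`, `not_isStronglyRegularAt_origin`). -/

namespace UniformAlgebra

open MeasureTheory Complex

/-! ### The operator `∂/∂z̄` and Cauchy's theorem for smooth cutoffs -/

/-- The Wirtinger derivative `∂ψ/∂z̄`. -/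
noncomputable def dbar (ψ : ℂ → ℂ) (z : ℂ) : ℂ :=
  (fderiv ℝ ψ z 1 + I * fderiv ℝ ψ z I) / 2

lemma dbar_mul {f g : ℂ → ℂ} {z : ℂ} (hf : DifferentiableAt ℝ f z)
    (hg : DifferentiableAt ℝ g z) :
    dbar (fun w => f w * g w) z = f z * dbar g z + g z * dbar f z := by
  simp only [dbar, fderiv_fun_mul hf hg, add_apply,
    smul_apply, smul_eq_mul]
  ring

lemma dbar_sub {f g : ℂ → ℂ} {z : ℂ} (hf : DifferentiableAt ℝ f z)
    (hg : DifferentiableAt ℝ g z) :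
    dbar (fun w => f w - g w) z = dbar f z - dbar g z := by
  simp only [dbar, fderiv_fun_sub hf hg, sub_apply]
  ring

lemma dbar_const_sub (c : ℂ) (f : ℂ → ℂ) (z : ℂ) :
    dbar (fun w => c - f w) z = - dbar f z := by
  simp only [dbar, fderiv_const_sub, neg_apply]
  ring

lemma dbar_eq_zero_of_eventually_const {f : ℂ → ℂ} {z c : ℂ} (h : ∀ᶠ w in 𝓝 z, f w = c) :
    dbar f z = 0 := by
  have : f =ᶠ[𝓝 z] fun _ => c := h
  simp [dbar, this.fderiv_eq]

lemma dbar_eq_zero_of_differentiableAt {h : ℂ → ℂ} {z : ℂ} (hh : DifferentiableAt ℂ h z) :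
    dbar h z = 0 := by
  have h1 : fderiv ℝ h z = (fderiv ℂ h z).restrictScalars ℝ :=
    (hh.hasFDerivAt.restrictScalars ℝ).fderiv
  have h2 : fderiv ℂ h z I = I * fderiv ℂ h z 1 := by simp
  simp only [dbar, h1, ContinuousLinearMap.coe_restrictScalars', h2]
  linear_combination (fderiv ℂ h z 1) / 2 * I_mul_I

lemma dbar_comp_affine {f : ℂ → ℂ} {c : ℂ} {r : ℝ} {z : ℂ}
    (hf : DifferentiableAt ℝ f ((z - c) / r)) :
    dbar (fun w => f ((w - c) / r)) z = dbar f ((z - c) / r) / r := by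
  have h1 : HasFDerivAt (fun w : ℂ => (w - c) / (r : ℂ))
      ((r⁻¹ : ℝ) • ContinuousLinearMap.id ℝ ℂ) z := by
    have := ((hasFDerivAt_id (𝕜 := ℝ) z).sub_const c).const_smul (r⁻¹ : ℝ)
    refine this.congr_of_eventuallyEq (Filter.Eventually.of_forall fun w => ?_)
    simp [div_eq_inv_mul]
  have h2 := (hf.hasFDerivAt.comp z h1).fderiv
  simp only [Function.comp_def] at h2
  have h3 : ∀ v : ℂ, (fderiv ℝ f ((z - c) / r)) ((r⁻¹ : ℝ) • v)
      = (r : ℂ)⁻¹ * fderiv ℝ f ((z - c) / r) v := by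
    intro v
    rw [map_smul]; simp
  simp only [dbar, h2, ContinuousLinearMap.comp_apply, smul_apply,
    ContinuousLinearMap.id_apply, h3]
  ring

lemma dbar_ofReal_comp {φ : ℝ → ℝ} {u : ℂ → ℝ} {z : ℂ} (hφ : DifferentiableAt ℝ φ (u z))
    (hu : DifferentiableAt ℝ u z) :
    dbar (fun w => ((φ (u w) : ℝ) : ℂ)) z =
      deriv φ (u z) * ((fderiv ℝ u z 1 + I * fderiv ℝ u z I) / 2) := by
  have h1 := (ofRealCLM.hasFDerivAt.comp z
    (hφ.hasDerivAt.comp_hasFDerivAt z hu.hasFDerivAt)).fderiv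
  have h1' : fderiv ℝ (fun w => ((φ (u w) : ℝ) : ℂ)) z =
    ofRealCLM.comp (deriv φ (u z) • fderiv ℝ u z) := h1
  simp only [dbar, h1', ContinuousLinearMap.comp_apply, smul_apply,
    smul_eq_mul, ofRealCLM_apply, ofReal_mul]
  ring

lemma continuous_dbar {ψ : ℂ → ℂ} (hψ : ContDiff ℝ 1 ψ) : Continuous (dbar ψ) := by
  have := hψ.continuous_fderiv (by norm_num)
  unfold dbar
  fun_prop

lemma measurable_dbar (ψ : ℂ → ℂ) : Measurable (dbar ψ) := by
  have h1 := measurable_fderiv_apply_const ℝ ψ 1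
  have h2 := measurable_fderiv_apply_const ℝ ψ I
  unfold dbar
  fun_prop

lemma dbar_eq_zero_of_notMem_tsupport {ψ : ℂ → ℂ} {z : ℂ} (hz : z ∉ tsupport ψ) :
    dbar ψ z = 0 :=
  dbar_eq_zero_of_eventually_const (c := 0)
    (notMem_tsupport_iff_eventuallyEq.1 hz)

lemma integral_fderiv_apply_eq_zero {F : ℂ → ℂ} (hF : ContDiff ℝ 1 F) (hc : HasCompactSupport F)
    (v : ℂ) : ∫ z, fderiv ℝ F z v = 0 := by
  have h1 : Continuous fun z => fderiv ℝ F z v :=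
    (hF.continuous_fderiv (by norm_num)).clm_apply continuous_const
  have h2 : HasCompactSupport fun z => fderiv ℝ F z v := hc.fderiv_apply ℝ v
  have := integral_mul_fderiv_eq_neg_fderiv_mul_of_integrable (μ := (volume : Measure ℂ))
    (f := fun _ => (1 : ℂ)) (g := F) (v := v) (by simp)
    (by simpa using h1.integrable_of_hasCompactSupport h2)
    (by simpa using hF.continuous.integrable_of_hasCompactSupport hc)
    (fun _ _ => differentiableAt_const _) (fun x _ => hF.differentiable (by norm_num) x)
  simpa using this

lemma integral_dbar_eq_zero {F : ℂ → ℂ} (hF : ContDiff ℝ 1 F) (hc : HasCompactSupport F) :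
    ∫ z, dbar F z = 0 := by
  have h1 : ∀ v, Integrable fun z => fderiv ℝ F z v := fun v =>
    ((hF.continuous_fderiv (by norm_num)).clm_apply
      continuous_const).integrable_of_hasCompactSupport (hc.fderiv_apply ℝ v)
  simp only [dbar]
  rw [integral_div, integral_add (h1 1) ((h1 I).const_mul I), integral_const_mul,
    integral_fderiv_apply_eq_zero hF hc, integral_fderiv_apply_eq_zero hF hc]
  simp

/-- Cauchy's theorem, in smooth form. -/
lemma integral_mul_dbar_eq_zero {h ψ : ℂ → ℂ} {U : Set ℂ} (hU : IsOpen U)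
    (hh : DifferentiableOn ℂ h U) (hψ : ContDiff ℝ 1 ψ) (hc : HasCompactSupport ψ)
    (hs : tsupport ψ ⊆ U) : ∫ z, h z * dbar ψ z = 0 := by
  have hF : ContDiff ℝ 1 fun z => h z * ψ z := by
    rw [contDiff_iff_contDiffAt]
    intro z
    by_cases hz : z ∈ tsupport ψ
    · have h1 : ContDiffAt ℂ 1 h z :=
        (hh.contDiffOn hU).contDiffAt (hU.mem_nhds (hs hz))
      exact (h1.restrict_scalars ℝ).mul hψ.contDiffAt
    · refine (contDiffAt_const (c := (0 : ℂ))).congr_of_eventuallyEq ?_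
      filter_upwards [notMem_tsupport_iff_eventuallyEq.1 hz] with w hw
      simp [hw]
  rw [← integral_dbar_eq_zero hF (hc.mul_left (f := h))]
  congr 1
  ext z
  by_cases hz : z ∈ tsupport ψ
  · have h1 : DifferentiableAt ℂ h z := hh.differentiableAt (hU.mem_nhds (hs hz))
    rw [dbar_mul (h1.restrictScalars ℝ) (hψ.differentiable (by norm_num) z),
      dbar_eq_zero_of_differentiableAt h1]
    simp
  · rw [dbar_eq_zero_of_notMem_tsupport hz,
      dbar_eq_zero_of_notMem_tsupport fun h' => hz (tsupport_mul_subset_right h')]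
    simp

/-! ### Radial bumps and Cauchy's formula -/

lemma deriv_smoothTransition_eq_zero_of_nonpos {t : ℝ} (ht : t ≤ 0) :
    deriv Real.smoothTransition t = 0 := by
  refine IsLocalMin.deriv_eq_zero (Filter.Eventually.of_forall fun x => ?_)
  rw [Real.smoothTransition.zero_of_nonpos ht]
  exact Real.smoothTransition.nonneg x

lemma deriv_smoothTransition_eq_zero_of_one_le {t : ℝ} (ht : 1 ≤ t) :
    deriv Real.smoothTransition t = 0 := by
  refine IsLocalMax.deriv_eq_zero (Filter.Eventually.of_forall fun x => ?_)
  rw [Real.smoothTransition.one_of_one_le ht]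
  exact Real.smoothTransition.le_one x

lemma differentiable_smoothTransition : Differentiable ℝ Real.smoothTransition :=
  (Real.smoothTransition.contDiff (n := 1)).differentiable (by norm_num)

lemma continuous_deriv_smoothTransition : Continuous (deriv Real.smoothTransition) :=
  (Real.smoothTransition.contDiff (n := 1)).continuous_deriv (by norm_num)

lemma exists_bound_deriv_smoothTransition :
    ∃ C : ℝ, 0 < C ∧ ∀ t, |deriv Real.smoothTransition t| ≤ C := by
  obtain ⟨C, hC⟩ := isCompact_Icc.exists_bound_of_continuousOn (s := Set.Icc (0 : ℝ) 1)
    continuous_deriv_smoothTransition.continuousOn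
  have h0 : 0 ≤ C := (norm_nonneg _).trans (hC 0 (by simp))
  refine ⟨C + 1, by linarith, fun t => ?_⟩
  by_cases ht : t ∈ Set.Icc (0 : ℝ) 1
  · have := hC t ht
    rw [Real.norm_eq_abs] at this; linarith
  · have : deriv Real.smoothTransition t = 0 := by
      rcases lt_or_ge t 0 with h | h
      · exact deriv_smoothTransition_eq_zero_of_nonpos h.le
      · exact deriv_smoothTransition_eq_zero_of_one_le
          (le_of_lt (not_le.1 fun h' => ht ⟨h, h'⟩))
    rw [this]; simp; linarith

/-- A smooth radial bump: `1` on the unit disc, `0` where `2 ≤ |z|²`. -/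
noncomputable def bump (z : ℂ) : ℂ := (Real.smoothTransition (2 - normSq z) : ℝ)

lemma contDiff_normSq : ContDiff ℝ 1 normSq := by
  have : (normSq : ℂ → ℝ) = fun z => reCLM z * reCLM z + imCLM z * imCLM z := by
    ext z; simp [normSq_apply]
  rw [this]; fun_prop

lemma fderiv_normSq (z v : ℂ) : fderiv ℝ normSq z v = 2 * (z.re * v.re + z.im * v.im) := by
  have : (normSq : ℂ → ℝ) = fun z => reCLM z * reCLM z + imCLM z * imCLM z := by
    ext z; simp [normSq_apply]
  rw [this, fderiv_fun_add (by fun_prop) (by fun_prop), fderiv_fun_mul (by fun_prop) (by fun_prop),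
    fderiv_fun_mul (by fun_prop) (by fun_prop)]
  simp
  ring

lemma contDiff_bump : ContDiff ℝ 1 bump := by
  have h := (Real.smoothTransition.contDiff (n := 1)).comp
    ((contDiff_const (c := (2 : ℝ))).sub contDiff_normSq)
  exact ofRealCLM.contDiff.comp h

lemma differentiable_bump : Differentiable ℝ bump := contDiff_bump.differentiable (by norm_num)

lemma norm_bump_le_one (z : ℂ) : ‖bump z‖ ≤ 1 := by
  rw [bump, norm_real, Real.norm_of_nonneg (Real.smoothTransition.nonneg _)]
  exact Real.smoothTransition.le_one _

lemma norm_one_sub_bump_le_one (z : ℂ) : ‖1 - bump z‖ ≤ 1 := by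
  rw [bump, ← ofReal_one, ← ofReal_sub, norm_real, Real.norm_of_nonneg]
  · linarith [Real.smoothTransition.nonneg (2 - normSq z)]
  · linarith [Real.smoothTransition.le_one (2 - normSq z)]

lemma bump_eq_one {z : ℂ} (hz : normSq z ≤ 1) : bump z = 1 := by
  rw [bump, Real.smoothTransition.one_of_one_le (by linarith)]; simp

lemma bump_eq_zero {z : ℂ} (hz : 2 ≤ normSq z) : bump z = 0 := by
  rw [bump, Real.smoothTransition.zero_of_nonpos (by linarith)]; simp

lemma dbar_bump (z : ℂ) : dbar bump z = -(deriv Real.smoothTransition (2 - normSq z) : ℝ) * z := by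
  have h1 : DifferentiableAt ℝ (fun w : ℂ => 2 - normSq w) z :=
    (contDiff_normSq.differentiable (by norm_num) z).const_sub 2
  have := dbar_ofReal_comp (u := fun w => 2 - normSq w) (z := z)
    (differentiable_smoothTransition _) h1
  have h2 : dbar bump z = dbar (fun w => ((Real.smoothTransition (2 - normSq w) : ℝ) : ℂ)) z := rfl
  rw [h2, this, fderiv_const_sub]
  simp only [neg_apply, fderiv_normSq]
  apply Complex.ext <;> simp <;> ring

lemma dbar_bump_eq_zero {z : ℂ} (hz : normSq z ≤ 1 ∨ 2 ≤ normSq z) : dbar bump z = 0 := by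
  rw [dbar_bump]
  rcases hz with h | h
  · rw [deriv_smoothTransition_eq_zero_of_one_le (by linarith)]; simp
  · rw [deriv_smoothTransition_eq_zero_of_nonpos (by linarith)]; simp

lemma hasCompactSupport_bump : HasCompactSupport bump := by
  refine HasCompactSupport.intro (isCompact_closedBall (0 : ℂ) 2) fun z hz => bump_eq_zero ?_
  rw [mem_closedBall_zero_iff, not_le] at hz
  rw [normSq_eq_norm_sq]; nlinarith

lemma hasCompactSupport_dbar {ψ : ℂ → ℂ} (hc : HasCompactSupport ψ) :
    HasCompactSupport (dbar ψ) :=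
  HasCompactSupport.intro hc fun _ hz => dbar_eq_zero_of_notMem_tsupport hz

lemma exists_bound_dbar_bump : ∃ C : ℝ, 0 < C ∧ ∀ z, ‖dbar bump z‖ ≤ C := by
  obtain ⟨C, hC⟩ := (hasCompactSupport_dbar hasCompactSupport_bump).exists_bound_of_continuous
    (continuous_dbar contDiff_bump)
  exact ⟨max C 1, by positivity, fun z => (hC z).trans (le_max_left _ _)⟩

lemma dbar_bump_div_self (z : ℂ) :
    dbar bump z / z = -((deriv Real.smoothTransition (2 - normSq z) : ℝ) : ℂ) := by
  rcases eq_or_ne z 0 with rfl | hz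
  · rw [deriv_smoothTransition_eq_zero_of_one_le (by simp)]; simp
  · rw [dbar_bump, mul_div_assoc, div_self hz, mul_one]

lemma continuous_dbar_bump_div_self : Continuous fun z => dbar bump z / z := by
  simp_rw [dbar_bump_div_self]
  exact (continuous_ofReal.comp (continuous_deriv_smoothTransition.comp
    (continuous_const.sub continuous_normSq))).neg

lemma integrable_dbar_bump_div_self : Integrable fun z => dbar bump z / z := by
  refine continuous_dbar_bump_div_self.integrable_of_hasCompactSupport ?_
  simp_rw [div_eq_mul_inv]
  exact (hasCompactSupport_dbar hasCompactSupport_bump).mul_right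

/-- Up to sign the integrand is a nonnegative continuous radial function that is not identically
zero. The integral is the constant of the smooth Cauchy formula; only its being nonzero is needed.
-/
lemma integral_dbar_bump_div_ne_zero : ∫ z, dbar bump z / z ≠ 0 := by
  set φ : ℂ → ℝ := fun z => deriv Real.smoothTransition (2 - normSq z) with hφ
  have hφc : Continuous φ := continuous_deriv_smoothTransition.comp
    (continuous_const.sub continuous_normSq)
  have h0 : ∀ z, 0 ≤ φ z := fun z => Real.smoothTransition.monotone.deriv_nonneg
  have hφs : HasCompactSupport φ := by
    refine HasCompactSupport.intro (isCompact_closedBall (0 : ℂ) 2) fun z hz => ?_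
    rw [mem_closedBall_zero_iff, not_le] at hz
    refine deriv_smoothTransition_eq_zero_of_nonpos ?_
    rw [normSq_eq_norm_sq]; nlinarith
  have h1 : ∫ z, dbar bump z / z = -((∫ z, φ z : ℝ) : ℂ) := by
    simp_rw [dbar_bump_div_self, integral_neg, ← integral_complex_ofReal]
    rfl
  rw [h1, neg_ne_zero, ofReal_ne_zero]
  obtain ⟨t, ⟨h2, h3⟩, h4⟩ :
      ∃ t ∈ Set.Ioo (0 : ℝ) 1, deriv Real.smoothTransition t = 1 := by
    simpa using exists_deriv_eq_slope Real.smoothTransition (a := 0) (b := 1) (by norm_num)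
      (Real.smoothTransition.continuous.continuousOn)
      (differentiable_smoothTransition.differentiableOn)
  refine (hφc.integral_pos_of_hasCompactSupport_nonneg_nonzero (μ := volume) hφs h0
    (x := ((Real.sqrt (2 - t) : ℝ) : ℂ)) ?_).ne'
  simp only [hφ, normSq_ofReal]
  rw [Real.mul_self_sqrt (by linarith), sub_sub_cancel, h4]
  exact one_ne_zero

lemma integrable_mul_dbar {h ψ : ℂ → ℂ} {U : Set ℂ} (hU : IsOpen U) (hh : ContinuousOn h U)
    (hψ : ContDiff ℝ 1 ψ) (hc : HasCompactSupport ψ) (hs : tsupport ψ ⊆ U) :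
    Integrable fun z => h z * dbar ψ z := by
  refine Continuous.integrable_of_hasCompactSupport ?_ (hasCompactSupport_dbar hc).mul_left
  rw [continuous_iff_continuousAt]
  intro z
  by_cases hz : z ∈ tsupport ψ
  · exact (hh.continuousAt (hU.mem_nhds (hs hz))).mul (continuous_dbar hψ).continuousAt
  · refine (continuousAt_const (y := (0 : ℂ))).congr ?_
    filter_upwards [(isClosed_tsupport ψ).isOpen_compl.mem_nhds hz] with w hw
    simp [dbar_eq_zero_of_notMem_tsupport hw]

/-- The bump `bump`, carried to the disc with centre `c` and radius `r`. -/
noncomputable def discBump (c : ℂ) (r : ℝ) (z : ℂ) : ℂ := bump ((z - c) / r)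

lemma contDiff_discBump (c : ℂ) (r : ℝ) : ContDiff ℝ 1 (discBump c r) := by
  refine contDiff_bump.comp ?_
  simp_rw [div_eq_mul_inv]
  fun_prop

lemma differentiable_discBump (c : ℂ) (r : ℝ) : Differentiable ℝ (discBump c r) :=
  (contDiff_discBump c r).differentiable (by norm_num)

lemma dbar_discBump (c : ℂ) (r : ℝ) (z : ℂ) :
    dbar (discBump c r) z = dbar bump ((z - c) / r) / r :=
  dbar_comp_affine (differentiable_bump _)

lemma normSq_sub_div (c z : ℂ) (r : ℝ) : normSq ((z - c) / r) = (‖z - c‖ / r) ^ 2 := by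
  rw [normSq_eq_norm_sq, norm_div, norm_real, Real.norm_eq_abs, div_pow, div_pow, sq_abs]

lemma discBump_eq_one {c z : ℂ} {r : ℝ} (hr : 0 < r) (hz : ‖z - c‖ ≤ r) :
    discBump c r z = 1 := by
  refine bump_eq_one ?_
  rw [normSq_sub_div]
  exact pow_le_one₀ (by positivity) ((div_le_one hr).2 hz)

lemma discBump_eq_zero {c z : ℂ} {r : ℝ} (hr : 0 < r) (hz : 3 / 2 * r ≤ ‖z - c‖) :
    discBump c r z = 0 := by
  refine bump_eq_zero ?_
  rw [normSq_sub_div]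
  have : 3 / 2 ≤ ‖z - c‖ / r := (le_div_iff₀ hr).2 hz
  nlinarith

lemma tsupport_discBump_subset (c : ℂ) {r : ℝ} (hr : 0 < r) :
    tsupport (discBump c r) ⊆ Metric.closedBall c (3 / 2 * r) := by
  refine closure_minimal (fun z hz => ?_) Metric.isClosed_closedBall
  rw [mem_closedBall_iff_norm]
  by_contra h
  exact hz (discBump_eq_zero hr (not_le.1 h).le)

lemma hasCompactSupport_discBump (c : ℂ) {r : ℝ} (hr : 0 < r) :
    HasCompactSupport (discBump c r) :=
  (isCompact_closedBall c (3 / 2 * r)).of_isClosed_subset (isClosed_tsupport _)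
    (tsupport_discBump_subset c hr)

lemma dbar_discBump_eq_zero {c z : ℂ} {r : ℝ} (hr : 0 < r)
    (hz : ‖z - c‖ ≤ r ∨ 3 / 2 * r ≤ ‖z - c‖) : dbar (discBump c r) z = 0 := by
  rw [dbar_discBump, dbar_bump_eq_zero, zero_div]
  rw [normSq_sub_div]
  refine hz.imp (fun h => pow_le_one₀ (by positivity) ((div_le_one hr).2 h)) fun h => ?_
  have : 3 / 2 ≤ ‖z - c‖ / r := (le_div_iff₀ hr).2 h
  nlinarith

/-- Cauchy's integral formula, in smooth form. -/
lemma integral_div_sub_mul_dbar_discBump {h : ℂ → ℂ} {a : ℂ} {r : ℝ} (hr : 0 < r)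
    (hh : DifferentiableOn ℂ h (Metric.ball a (2 * r))) :
    Integrable (fun z => h z / (z - a) * dbar (discBump a r) z) ∧
      ∫ z, h z / (z - a) * dbar (discBump a r) z = h a * ∫ z, dbar bump z / z := by
  have hs : tsupport (discBump a r) ⊆ Metric.ball a (2 * r) :=
    (tsupport_discBump_subset a hr).trans (Metric.closedBall_subset_ball (by linarith))
  -- Split `h z / (z - a)` into the holomorphic difference quotient, killed by Cauchy's theorem, and
  -- `h a / (z - a)`, which rescales to the constant for the unit bump.
  have hd : DifferentiableOn ℂ (dslope h a) (Metric.ball a (2 * r)) :=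
    (Complex.differentiableOn_dslope (Metric.ball_mem_nhds a (by linarith))).2 hh
  have h1 := integral_mul_dbar_eq_zero Metric.isOpen_ball hd (contDiff_discBump a r)
    (hasCompactSupport_discBump a hr) hs
  have h2 := integrable_mul_dbar Metric.isOpen_ball hd.continuousOn (contDiff_discBump a r)
    (hasCompactSupport_discBump a hr) hs
  set k : ℂ → ℂ := fun z => dbar bump z / z with hk
  have h3 : ∀ z, h z / (z - a) * dbar (discBump a r) z =
      dslope h a z * dbar (discBump a r) z + h a / (r : ℂ) ^ 2 * k (r⁻¹ • (z - a)) := by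
    intro z
    rw [dbar_discBump]
    rcases eq_or_ne z a with rfl | hz
    · simp [hk, dbar_bump]
    · have hz' : z - a ≠ 0 := sub_ne_zero.2 hz
      have hr' : (r : ℂ) ≠ 0 := ofReal_ne_zero.2 hr.ne'
      have : r⁻¹ • (z - a) = (z - a) / r := by simp [div_eq_inv_mul]
      rw [dslope_of_ne _ hz, slope_def_field, hk, this]
      field_simp
      ring
  have h4 : Integrable fun z => k (r⁻¹ • (z - a)) :=
    (integrable_dbar_bump_div_self.comp_smul (inv_ne_zero hr.ne')).comp_sub_right a
  simp_rw [h3]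
  refine ⟨h2.add (h4.const_mul _), ?_⟩
  rw [integral_add h2 (h4.const_mul _), h1, integral_const_mul,
    integral_sub_right_eq_self (fun z => k (r⁻¹ • z)) a,
    Measure.integral_comp_inv_smul_of_nonneg _ _ hr.le, Complex.finrank_real_complex, zero_add]
  have hr' : (r : ℂ) ≠ 0 := ofReal_ne_zero.2 hr.ne'
  simp only [real_smul, ofReal_pow]
  field_simp

/-! ### Rational ring factors and McKissick's discs -/

/-- Away from small discs about the `m`-th roots of unity, `1 - w ^ m` is not small. -/
lemma le_norm_one_sub_pow {m : ℕ} (hm : m ≠ 0) {w : ℂ} {t : ℝ} (ht : t ≤ 1 / 4)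
    (hw : ∀ ω : ℂ, ω ^ m = 1 → 4 * t / m ≤ ‖w - ω‖) : t ≤ ‖1 - w ^ m‖ := by
  by_contra! hlt
  set s := ‖1 - w ^ m‖ with hs
  have hm0 : (0 : ℝ) < m := Nat.cast_pos.2 (Nat.pos_of_ne_zero hm)
  have hm1 : (1 : ℝ) ≤ m := Nat.one_le_cast.2 (Nat.pos_of_ne_zero hm)
  have hs0 : 0 ≤ s := norm_nonneg _
  have hs' : ‖w ^ m - 1‖ = s := by rw [hs, norm_sub_rev]
  have hW : w ^ m ≠ 0 := by
    intro h
    rw [hs, h] at hlt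
    norm_num at hlt
    linarith
  -- Dividing `w` by the small `m`-th root `exp (ℓ / m)` of `w ^ m` gives a root of unity within `3
  -- s / m` of `w`, closer than `hw` allows.
  set ℓ := Complex.log (w ^ m) with hℓ
  have hℓs : ‖ℓ‖ ≤ 3 / 2 * s := by
    have := Complex.norm_log_one_add_half_le_self (z := w ^ m - 1) (by rw [hs']; linarith)
    rwa [add_sub_cancel, hs'] at this
  have hv : Complex.exp (ℓ / m) ^ m = w ^ m := by
    rw [← Complex.exp_nat_mul, mul_div_cancel₀ _ (Nat.cast_ne_zero.2 hm), hℓ, Complex.exp_log hW]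
  have hv0 := Complex.exp_ne_zero (ℓ / m)
  have hω : (w / Complex.exp (ℓ / m)) ^ m = 1 := by rw [div_pow, hv, div_self hW]
  have hω1 : ‖w / Complex.exp (ℓ / m)‖ = 1 := Complex.norm_eq_one_of_pow_eq_one hω hm
  have h1 : ‖ℓ / m‖ ≤ 3 / 2 * s / m := by
    rw [norm_div, Complex.norm_natCast]
    gcongr
  have h2 : ‖Complex.exp (ℓ / m) - 1‖ ≤ 2 * (3 / 2 * s / m) := by
    refine (Complex.norm_exp_sub_one_le (h1.trans ?_)).trans (by gcongr)
    rw [div_le_one hm0]; linarith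
  have h3 : w - w / Complex.exp (ℓ / m) =
      w / Complex.exp (ℓ / m) * (Complex.exp (ℓ / m) - 1) := by
    field_simp
  have h4 := hw _ hω
  rw [h3, norm_mul, hω1, one_mul] at h4
  have h5 := h4.trans h2
  rw [← mul_div_assoc, div_le_div_iff_of_pos_right hm0] at h5
  nlinarith

/-- The factor with poles at the points `c + ρ ω`, where `ω ^ m = 1`. -/
noncomputable def ringFactor (c : ℂ) (ρ : ℝ) (m : ℕ) (z : ℂ) : ℂ := (1 - ((z - c) / ρ) ^ m)⁻¹

/-- The centres of the discs to be removed about the poles of `ringFactor c ρ m`. -/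
noncomputable def ringCenter (c : ℂ) (ρ : ℝ) {m : ℕ} (ω : nthRootsFinset m (1 : ℂ)) : ℂ :=
  c + ρ * (ω : ℂ)

lemma norm_ringCenter_sub (c : ℂ) {ρ : ℝ} (hρ : 0 < ρ) {m : ℕ} (hm : m ≠ 0)
    (ω : nthRootsFinset m (1 : ℂ)) : ‖ringCenter c ρ ω - c‖ = ρ := by
  have h : (ω : ℂ) ^ m = 1 := (mem_nthRootsFinset (Nat.pos_of_ne_zero hm) _).1 ω.2
  rw [ringCenter, add_sub_cancel_left, norm_mul, Complex.norm_eq_one_of_pow_eq_one h hm, mul_one,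
    norm_real, Real.norm_of_nonneg hρ.le]

lemma le_norm_one_sub_ring {c z : ℂ} {ρ t : ℝ} (hρ : 0 < ρ) {m : ℕ} (hm : m ≠ 0)
    (ht : t ≤ 1 / 4)
    (hz : ∀ ω : nthRootsFinset m (1 : ℂ), z ∉ Metric.ball (ringCenter c ρ ω) (ρ * (4 * t / m))) :
    t ≤ ‖1 - ((z - c) / ρ) ^ m‖ := by
  refine le_norm_one_sub_pow hm ht fun ω hω => ?_
  have h := hz ⟨ω, (mem_nthRootsFinset (Nat.pos_of_ne_zero hm) _).2 hω⟩
  rw [mem_ball_iff_norm, not_lt] at h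
  have hρ' : (ρ : ℂ) ≠ 0 := ofReal_ne_zero.2 hρ.ne'
  have h1 : z - ringCenter c ρ ⟨ω, (mem_nthRootsFinset (Nat.pos_of_ne_zero hm) _).2 hω⟩ =
      ρ * ((z - c) / ρ - ω) := by
    rw [ringCenter]; field_simp; ring
  rw [h1, norm_mul, norm_real, Real.norm_of_nonneg hρ.le] at h
  exact le_of_mul_le_mul_left h hρ

/-- With `w = ((z - c) / ρ) ^ m`, a large `m` makes `w` uniformly small on the inner disc and
uniformly large on the outer region, so `1 / (1 - w)` is close to `1` and to `0` respectively. -/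
lemma exists_ring_exponent {σ ρ σ' τ : ℝ} (h0 : 0 ≤ σ) (h1 : σ < ρ) (h2 : ρ < σ') (hτ : 0 < τ) :
    ∃ m : ℕ, m ≠ 0 ∧ ∀ c z : ℂ, (‖z - c‖ ≤ σ → ‖ringFactor c ρ m z - 1‖ ≤ τ) ∧
      (σ' ≤ ‖z - c‖ → ‖ringFactor c ρ m z‖ ≤ τ) := by
  have hρ : 0 < ρ := h0.trans_lt h1
  have e1 : ∀ᶠ m : ℕ in Filter.atTop, (σ / ρ) ^ m < min (1 / 2) (τ / 2) :=
    (tendsto_pow_atTop_nhds_zero_of_lt_one (by positivity) ((div_lt_one hρ).2 h1)).eventually_lt_const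
      (by positivity)
  have e2 : ∀ᶠ m : ℕ in Filter.atTop, 1 + τ⁻¹ ≤ (σ' / ρ) ^ m :=
    (tendsto_pow_atTop_atTop_of_one_lt ((one_lt_div hρ).2 h2)).eventually_ge_atTop _
  obtain ⟨m, ⟨hm1, hm2⟩, hm0⟩ := ((e1.and e2).and (Filter.eventually_ne_atTop 0)).exists
  refine ⟨m, hm0, fun c z => ⟨fun hz => ?_, fun hz => ?_⟩⟩
  · set w := ((z - c) / ρ) ^ m with hw
    have hwn : ‖w‖ ≤ (σ / ρ) ^ m := by
      rw [hw, norm_pow, norm_div, norm_real, Real.norm_of_nonneg hρ.le]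
      gcongr
    have a1 : ‖w‖ ≤ 1 / 2 := hwn.trans (hm1.le.trans (min_le_left _ _))
    have a2 : ‖w‖ ≤ τ / 2 := hwn.trans (hm1.le.trans (min_le_right _ _))
    have a3 : 1 / 2 ≤ ‖1 - w‖ := by
      have := norm_sub_norm_le 1 w
      rw [norm_one] at this; linarith
    have a4 : 1 - w ≠ 0 := by rw [← norm_pos_iff]; linarith
    have a5 : ringFactor c ρ m z - 1 = w / (1 - w) := by
      rw [ringFactor, ← hw]; field_simp; ring
    rw [a5, norm_div, div_le_iff₀ (by linarith)]
    nlinarith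
  · set w := ((z - c) / ρ) ^ m with hw
    have hwn : (σ' / ρ) ^ m ≤ ‖w‖ := by
      rw [hw, norm_pow, norm_div, norm_real, Real.norm_of_nonneg hρ.le]
      have : 0 ≤ σ' := by linarith
      gcongr
    have a3 : τ⁻¹ ≤ ‖1 - w‖ := by
      have := norm_sub_norm_le w 1
      rw [norm_one, norm_sub_rev] at this; linarith
    rw [ringFactor, ← hw, norm_inv]
    exact inv_le_of_inv_le₀ hτ a3

lemma mem_ratFunctions_of_eval {K : TopologicalSpace.Compacts ℂ} (p q : ℂ[X])
    (hq : ∀ z ∈ K, q.eval z ≠ 0) :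
    ∃ f ∈ ratFunctions K, ∀ z : K, f z = p.eval (z : ℂ) / q.eval (z : ℂ) := by
  refine ⟨⟨fun z => p.eval (z : ℂ) / q.eval (z : ℂ), ?_⟩, ⟨p, q, hq, fun z => rfl⟩, fun z => rfl⟩
  exact (p.continuous.comp continuous_subtype_val).div (q.continuous.comp continuous_subtype_val)
    fun z => hq z z.2

lemma ratFunctions_le_R (K : TopologicalSpace.Compacts ℂ) : ratFunctions K ≤ R K :=
  Subalgebra.le_topologicalClosure _

lemma exists_ringFactor_mem {K : TopologicalSpace.Compacts ℂ} (c : ℂ) (ρ : ℝ) (m : ℕ)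
    (h : ∀ z ∈ K, 1 - ((z - c) / ρ) ^ m ≠ 0) :
    ∃ f ∈ ratFunctions K, ∀ z : K, f z = ringFactor c ρ m z := by
  obtain ⟨f, hf, hfz⟩ := mem_ratFunctions_of_eval (K := K) 1
    (1 - (C (ρ : ℂ)⁻¹ * (X - C c)) ^ m) (fun z hz => by simpa [div_eq_inv_mul] using h z hz)
  exact ⟨f, hf, fun z => by rw [hfz, ringFactor]; simp [div_eq_inv_mul]⟩

/-- Convergence of the products of ring factors. -/
lemma exists_limit_of_factors {K : TopologicalSpace.Compacts ℂ} {u : ℕ → C(K, ℂ)}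
    (hu : ∀ n, u n ∈ ratFunctions K) {B τ σ : ℕ → ℝ} {c : ℂ} {R₀ : ℝ} (hB : ∀ n, 1 ≤ B n)
    (hτ0 : ∀ n, 0 ≤ τ n)
    (hτ : ∀ n, τ n * ((∏ k ∈ Finset.range n, B k) * (1 + B (n + 1))) ≤ (1 / 2) ^ (n + 2))
    (hσ : Monotone σ) (hσR : ∀ n, σ n ≤ R₀)
    (huB : ∀ n z, ‖u n z‖ ≤ B n)
    (hin : ∀ n (z : K), ‖(z : ℂ) - c‖ ≤ σ n → ‖u n z - 1‖ ≤ τ n)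
    (hout : ∀ n (z : K), σ (n + 1) ≤ ‖(z : ℂ) - c‖ → ‖u n z‖ ≤ τ n) :
    ∃ f ∈ R K, (∀ z : K, R₀ ≤ ‖(z : ℂ) - c‖ → f z = 0) ∧
      ∀ z : K, ‖(z : ℂ) - c‖ ≤ σ 0 → f z ≠ 0 := by
  set h : ℕ → C(K, ℂ) := fun N => ∏ k ∈ Finset.range N, u k with hh
  set P : ℕ → ℝ := fun N => ∏ k ∈ Finset.range N, B k with hP
  have hP0 : ∀ N, 0 ≤ P N := fun N =>
    Finset.prod_nonneg fun k _ => zero_le_one.trans (hB k)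
  have hsucc : ∀ N z, h (N + 1) z = h N z * u N z := by
    intro N z; simp [hh, Finset.prod_range_succ]
  have hmem : ∀ N, h N ∈ ratFunctions K := fun N => prod_mem fun k _ => hu k
  have hhP : ∀ N z, ‖h N z‖ ≤ P N := by
    intro N z
    simp only [hh, hP, ContinuousMap.coe_prod, Finset.prod_apply, norm_prod]
    exact Finset.prod_le_prod (fun _ _ => norm_nonneg _) fun k _ => huB k z
  have hτP : ∀ n, P n * τ n ≤ (1 / 2) ^ (n + 2) := by
    intro n
    refine le_trans ?_ (hτ n)
    rw [mul_comm]
    have := hB (n + 1)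
    have h1 := hP0 n
    have h2 := mul_nonneg (hτ0 n) h1
    nlinarith
  have hin' : ∀ N (z : K), ‖(z : ℂ) - c‖ ≤ σ N → ‖h N z * (u N z - 1)‖ ≤ (1 / 2) ^ (N + 2) := by
    intro N z hz
    rw [norm_mul]
    exact (mul_le_mul (hhP N z) (hin N z hz) (norm_nonneg _) (hP0 N)).trans (hτP N)
  have hout' : ∀ N (z : K), σ (N + 1) ≤ ‖(z : ℂ) - c‖ → ‖h (N + 1) z‖ ≤ P N * τ N := by
    intro N z hz
    rw [hsucc, norm_mul]
    exact mul_le_mul (hhP N z) (hout N z hz) (norm_nonneg _) (hP0 N)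
  -- Within radius `σ (N + 1)` the new factor is close to `1`. Beyond it, the new factor may be as
  -- large as `B (N + 1)`, but the preceding factor is already tiny; hence the shift of index by
  -- one.
  have hdist : ∀ N, dist (h (N + 1)) (h (N + 1 + 1)) ≤ 1 * (1 / 2) ^ N := by
    intro N
    rw [ContinuousMap.dist_le (by positivity)]
    intro z
    have e : h (N + 1 + 1) z - h (N + 1) z = h (N + 1) z * (u (N + 1) z - 1) := by
      rw [hsucc (N + 1)]; ring
    rw [dist_comm, dist_eq_norm, e, one_mul]
    rcases le_total ‖(z : ℂ) - c‖ (σ (N + 1)) with hz | hz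
    · refine (hin' _ z hz).trans (pow_le_pow_of_le_one (by norm_num) (by norm_num) (by omega))
    · rw [norm_mul]
      have h1 : ‖u (N + 1) z - 1‖ ≤ 1 + B (N + 1) := by
        refine (norm_sub_le _ _).trans ?_
        rw [norm_one, add_comm]
        gcongr
        exact huB _ _
      calc _ ≤ (P N * τ N) * (1 + B (N + 1)) :=
            mul_le_mul (hout' N z hz) h1 (norm_nonneg _) (mul_nonneg (hP0 N) (hτ0 N))
        _ = τ N * (P N * (1 + B (N + 1))) := by ring
        _ ≤ (1 / 2) ^ (N + 2) := hτ N
        _ ≤ (1 / 2) ^ N := pow_le_pow_of_le_one (by norm_num) (by norm_num) (by omega)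
  obtain ⟨f, hf⟩ := cauchySeq_tendsto_of_complete
    (cauchySeq_of_le_geometric (1 / 2) 1 (by norm_num) hdist)
  have hfz : ∀ z, Filter.Tendsto (fun N => h (N + 1) z) Filter.atTop (𝓝 (f z)) := fun z =>
    ((continuous_eval_const (F := C(K, ℂ)) z).tendsto f).comp hf
  refine ⟨f, mem_closure_of_tendsto hf (Filter.Eventually.of_forall fun N => hmem _), ?_, ?_⟩
  · intro z hz
    refine tendsto_nhds_unique (hfz z) ?_
    refine squeeze_zero_norm (a := fun N : ℕ => (1 / 2 : ℝ) ^ (N + 2)) (fun N => ?_) ?_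
    · exact (hout' N z ((hσR _).trans hz)).trans (hτP N)
    · exact (tendsto_pow_atTop_nhds_zero_of_lt_one (by norm_num) (by norm_num)).comp
        (Filter.tendsto_add_atTop_nat 2)
  · intro z hz hfz0
    -- Within `σ 0` every factor is close to `1`, and the geometric errors keep all partial products
    -- within `1 / 2` of `1`.
    have h1 : ∀ N, ‖h N z - 1‖ ≤ 1 / 2 - (1 / 2) ^ (N + 1) := by
      intro N
      induction N with
      | zero => simp [hh]
      | succ N ih =>
        have e : h (N + 1) z - 1 = (h N z - 1) + h N z * (u N z - 1) := by
          rw [hsucc]; ring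
        have := hin' N z (hz.trans (hσ (Nat.zero_le N)))
        rw [e]
        refine (norm_add_le _ _).trans ?_
        have e2 : (1 / 2 : ℝ) ^ (N + 1) = 2 * (1 / 2) ^ (N + 2) := by rw [pow_succ _ (N + 1)]; ring
        rw [e2] at ih
        linarith
    have h2 := le_of_tendsto ((hfz z).sub_const 1).norm
      (Filter.Eventually.of_forall fun N => (h1 (N + 1)).trans
        (sub_le_self _ (by positivity)))
    rw [hfz0] at h2
    norm_num at h2

open scoped ENNReal NNReal

lemma card_nthRootsFinset_le (m : ℕ) : (nthRootsFinset m (1 : ℂ)).card ≤ m := by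
  classical
  rw [nthRootsFinset]
  exact (Multiset.toFinset_card_le _).trans (card_nthRoots m 1)

/-- McKissick's discs: removing discs of small total radius, with centres in an
annulus, makes room for functions supported on a disc. -/
lemma exists_mckissick_discs (c : ℂ) {R₀ ε : ℝ} (hR : 0 < R₀) (hε : 0 < ε) :
    ∃ (ι : Type) (ctr : ι → ℂ) (rad : ι → ℝ), (∀ i, 0 < rad i) ∧
      (∀ i, R₀ / 2 < ‖ctr i - c‖ ∧ ‖ctr i - c‖ < R₀) ∧
      ∑' i, ENNReal.ofReal (rad i) ≤ ENNReal.ofReal ε ∧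
      ∀ K : TopologicalSpace.Compacts ℂ, (∀ i, ∀ z ∈ K, z ∉ Metric.ball (ctr i) (rad i)) →
        ∃ f ∈ R K, (∀ z : K, R₀ ≤ ‖(z : ℂ) - c‖ → f z = 0) ∧
          ∀ z : K, ‖(z : ℂ) - c‖ ≤ R₀ / 2 → f z ≠ 0 := by
  -- The radii interlace, `σ n < ρ n < σ (n + 1)`, starting at `σ 0 = R₀ / 2` and staying below
  -- `R₀`.
  set ρ : ℕ → ℝ := fun n => R₀ * (1 - 1 / (2 * n + 3)) with hρ
  set σ : ℕ → ℝ := fun n => R₀ * (1 - 1 / (2 * n + 2)) with hσ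
  have hρR : ∀ n, ρ n < R₀ := by
    intro n
    have : (0 : ℝ) < 1 / (2 * n + 3) := by positivity
    simp only [hρ]; nlinarith
  have hσ0 : σ 0 = R₀ / 2 := by simp only [hσ]; norm_num; ring
  have hσρ : ∀ n, σ n < ρ n := by
    intro n
    simp only [hρ, hσ]
    gcongr
    norm_num
  have hρσ : ∀ n, ρ n < σ (n + 1) := by
    intro n
    refine mul_lt_mul_of_pos_left (sub_lt_sub_left (one_div_lt_one_div_of_lt (by positivity) ?_) _) hR
    push_cast; linarith
  have hσm : Monotone σ := monotone_nat_of_le_succ fun n => ((hσρ n).trans (hρσ n)).le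
  have hσp : ∀ n, 0 < σ n := fun n =>
    (by rw [hσ0]; positivity : 0 < σ 0).trans_le (hσm (Nat.zero_le n))
  have hρp : ∀ n, 0 < ρ n := fun n => (hσp n).trans (hσρ n)
  obtain ⟨e, he0, he⟩ := ENNReal.exists_pos_sum_of_countable
    (ENNReal.ofReal_pos.2 hε).ne' ℕ
  -- The lower bounds `t n` for the denominators, and with them the bounds `B n` and tolerances `τ
  -- n`, are fixed before the exponents `m n`. This is not circular: the discs of the `n`-th ring
  -- have total radius at most `4 * ρ n * t n`, whatever `m n` is.
  set t : ℕ → ℝ := fun n => min (1 / 4) (e n / (4 * R₀)) with ht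
  have ht0 : ∀ n, 0 < t n := fun n => lt_min (by norm_num)
    (div_pos (NNReal.coe_pos.2 (he0 n)) (by positivity))
  have ht4 : ∀ n, t n ≤ 1 / 4 := fun n => min_le_left _ _
  have hte : ∀ n, 4 * R₀ * t n ≤ e n := by
    intro n
    have : t n ≤ e n / (4 * R₀) := min_le_right _ _
    rwa [le_div_iff₀ (by positivity), mul_comm] at this
  set B : ℕ → ℝ := fun n => (t n)⁻¹ with hB
  have hB1 : ∀ n, 1 ≤ B n := fun n => (one_le_inv₀ (ht0 n)).2 ((ht4 n).trans (by norm_num))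
  set D : ℕ → ℝ := fun n => (∏ k ∈ Finset.range n, B k) * (1 + B (n + 1)) with hD
  have hD0 : ∀ n, 0 < D n := fun n => mul_pos
    (Finset.prod_pos fun k _ => zero_lt_one.trans_le (hB1 k)) (by linarith [hB1 (n + 1)])
  set τ : ℕ → ℝ := fun n => (1 / 2) ^ (n + 2) / D n with hτ
  have hτ0 : ∀ n, 0 < τ n := fun n => div_pos (by positivity) (hD0 n)
  choose m hm0 hm using fun n =>
    exists_ring_exponent (hσp n).le (hσρ n) (hρσ n) (hτ0 n)
  have hmp : ∀ n, (0 : ℝ) < m n := fun n => Nat.cast_pos.2 (Nat.pos_of_ne_zero (hm0 n))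
  refine ⟨Σ n, nthRootsFinset (m n) (1 : ℂ), fun i => ringCenter c (ρ i.1) i.2,
    fun i => ρ i.1 * (4 * t i.1 / m i.1), ?_, ?_, ?_, ?_⟩
  · intro i
    have := hρp i.1
    have := ht0 i.1
    have := hmp i.1
    positivity
  · intro i
    rw [norm_ringCenter_sub c (hρp i.1) (hm0 i.1)]
    refine ⟨?_, hρR _⟩
    rw [← hσ0]
    exact (hσm (Nat.zero_le _)).trans_lt (hσρ _)
  · rw [ENNReal.tsum_sigma']
    refine le_trans (ENNReal.tsum_le_tsum fun n => ?_) he.le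
    rw [tsum_fintype]
    simp only [Finset.sum_const, Finset.card_univ, Fintype.card_coe, nsmul_eq_mul]
    rw [← ENNReal.ofReal_natCast, ← ENNReal.ofReal_mul (by positivity), ← ENNReal.ofReal_coe_nnreal]
    refine ENNReal.ofReal_le_ofReal (le_trans ?_ (hte n))
    have h1 : ((nthRootsFinset (m n) (1 : ℂ)).card : ℝ) ≤ m n :=
      Nat.cast_le.2 (card_nthRootsFinset_le _)
    have h2 := hρp n
    have h3 := ht0 n
    have h4 := hmp n
    calc _ ≤ (m n : ℝ) * (ρ n * (4 * t n / m n)) := by gcongr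
      _ = 4 * ρ n * t n := by field_simp
      _ ≤ 4 * R₀ * t n := by
        have := (hρR n).le
        gcongr
  · intro K hK
    have hlow : ∀ n, ∀ z ∈ K, t n ≤ ‖1 - ((z - c) / ρ n) ^ m n‖ := fun n z hz =>
      le_norm_one_sub_ring (hρp n) (hm0 n) (ht4 n) fun ω => hK ⟨n, ω⟩ z hz
    choose u hu huz using fun n => exists_ringFactor_mem (K := K) c (ρ n) (m n)
      fun z hz => norm_pos_iff.1 ((ht0 n).trans_le (hlow n z hz))
    have := exists_limit_of_factors hu (B := B) (τ := τ) (σ := σ) (c := c) (R₀ := R₀) hB1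
      (fun n => (hτ0 n).le) (fun n => ?_) hσm (fun n => ((hσρ n).trans (hρR n)).le) ?_ ?_ ?_
    · rwa [hσ0] at this
    · rw [hτ]; simp only
      rw [div_mul_cancel₀ _ (hD0 n).ne']
    · intro n z
      rw [huz, ringFactor, norm_inv]
      exact inv_anti₀ (ht0 n) (hlow n z z.2)
    · intro n z hz
      rw [huz]
      exact (hm n c z).1 hz
    · intro n z hz
      rw [huz]
      exact (hm n c z).2 hz

/-! ### Characters of `R(K)` and normality -/

variable {K : TopologicalSpace.Compacts ℂ}

lemma isClosed_R (K : TopologicalSpace.Compacts ℂ) : IsClosed (R K : Set C(K, ℂ)) :=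
  Subalgebra.isClosed_topologicalClosure _

/-- The coordinate function on `K`. -/
def coord (K : TopologicalSpace.Compacts ℂ) : C(K, ℂ) := ⟨fun z => z, continuous_subtype_val⟩

lemma coord_mem_ratFunctions (K : TopologicalSpace.Compacts ℂ) : coord K ∈ ratFunctions K :=
  ⟨X, 1, by simp, by simp [coord]⟩

lemma coord_mem (K : TopologicalSpace.Compacts ℂ) : coord K ∈ R K :=
  ratFunctions_le_R K (coord_mem_ratFunctions K)

lemma isUniformAlgebra_R (K : TopologicalSpace.Compacts ℂ) : IsUniformAlgebra (R K) where
  isClosed := isClosed_R K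
  separatesPoints := by
    intro x y hxy
    exact ⟨coord K, ⟨coord K, coord_mem K, rfl⟩, fun h => hxy (Subtype.ext h)⟩

instance instCompleteSpaceR (K : TopologicalSpace.Compacts ℂ) : CompleteSpace (R K) :=
  (isClosed_R K).completeSpace_coe

/-- Characters of `R K` are determined by their values on the rational functions. -/
lemma algHom_eq_of_ratFunctions {φ ψ : R K →ₐ[ℂ] ℂ}
    (h : ∀ f (hf : f ∈ ratFunctions K), φ ⟨f, ratFunctions_le_R K hf⟩ =
      ψ ⟨f, ratFunctions_le_R K hf⟩) : φ = ψ := by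
  have hφ : Continuous φ := map_continuous φ
  have hψ : Continuous ψ := map_continuous ψ
  ext f
  obtain ⟨s, hs, hlim⟩ := mem_closure_iff_seq_limit.1 (show (f : C(K, ℂ)) ∈
    closure (ratFunctions K : Set C(K, ℂ)) from f.2)
  have hlim' : Filter.Tendsto (fun n => (⟨s n, ratFunctions_le_R K (hs n)⟩ : R K)) Filter.atTop
      (𝓝 f) := tendsto_subtype_rng.2 hlim
  have h1 := (hφ.tendsto f).comp hlim'
  have h2 := (hψ.tendsto f).comp hlim'
  refine tendsto_nhds_unique h1 (h2.congr fun n => ?_)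
  exact (h _ (hs n)).symm

lemma aeval_coord_apply (p : ℂ[X]) (z : K) :
    aeval (coord K) p z = p.eval (z : ℂ) := by
  have := Polynomial.aeval_algHom_apply (ContinuousMap.evalAlgHom ℂ ℂ z) (coord K) p
  have h2 : (ContinuousMap.evalAlgHom ℂ ℂ z) (coord K) = (z : ℂ) := rfl
  rw [h2, Polynomial.coe_aeval_eq_eval] at this
  exact this.symm

/-- A character sends the coordinate function to some `λ`. If `λ` were outside `K`, then `z - λ`
would be invertible in `R K` although the character kills it. So `λ ∈ K`, and the character agrees
with evaluation at `λ` on rational functions, which are dense. -/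
lemma isNatural_R (K : TopologicalSpace.Compacts ℂ) : IsNatural (R K) := by
  constructor
  · intro x y hxy
    exact Subtype.ext (congrArg (fun φ : R K →ₐ[ℂ] ℂ => φ ⟨coord K, coord_mem K⟩) hxy)
  · intro φ
    set Z : R K := ⟨coord K, coord_mem K⟩ with hZ
    have hZp : ∀ (p : ℂ[X]), ((aeval Z p : R K) : C(K, ℂ)) = aeval (coord K) p := fun p =>
      (Polynomial.aeval_algHom_apply (R K).val Z p).symm
    have hφp : ∀ p : ℂ[X], φ (aeval Z p) = p.eval (φ Z) := fun p => by
      rw [← Polynomial.aeval_algHom_apply, Polynomial.coe_aeval_eq_eval]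
    have hrat : ∀ f (hf : f ∈ ratFunctions K) (p q : ℂ[X]),
        (∀ z : K, q.eval (z : ℂ) * f z = p.eval (z : ℂ)) →
        q.eval (φ Z) * φ ⟨f, ratFunctions_le_R K hf⟩ = p.eval (φ Z) := by
      intro f hf p q hz
      rw [← hφp, ← hφp, ← map_mul]
      congr 1
      ext z
      have := hz z
      rw [← aeval_coord_apply, ← aeval_coord_apply] at this
      rw [MulMemClass.coe_mul, ContinuousMap.mul_apply, hZp, hZp]
      exact this
    have hmem : φ Z ∈ K := by
      by_contra hK
      obtain ⟨f, hf, hfz⟩ := mem_ratFunctions_of_eval (K := K) 1 (X - C (φ Z)) (fun z hz => by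
        simpa [sub_eq_zero] using fun h : z = φ Z => hK (h ▸ hz))
      have := hrat f hf 1 (X - C (φ Z)) fun z => by
        rw [hfz, mul_div_cancel₀]
        simpa [sub_eq_zero] using fun h : (z : ℂ) = φ Z => hK (h ▸ z.2)
      simp at this
    refine ⟨⟨φ Z, hmem⟩, algHom_eq_of_ratFunctions fun f hf => ?_⟩
    obtain ⟨p, q, hq, hfz⟩ := id hf
    have h1 := hrat f hf p q fun z => by rw [hfz, mul_div_cancel₀ _ (hq z z.2)]
    change f ⟨φ Z, hmem⟩ = _
    rw [hfz, div_eq_iff (hq _ hmem), ← h1, mul_comm]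

/-- The ideal of the functions in `A` that vanish on `E`. -/
def vanishingIdeal {X : Type*} [TopologicalSpace X] (A : Subalgebra ℂ C(X, ℂ)) (E : Set X) :
    Ideal A where
  carrier := {f | ∀ x ∈ E, (f : C(X, ℂ)) x = 0}
  zero_mem' := by simp
  add_mem' := by
    intro f g hf hg x hx
    simp [hf x hx, hg x hx]
  smul_mem' := by
    intro c f hf x hx
    simp [hf x hx]

/-- A natural uniform algebra that separates points from closed sets is normal. -/
lemma isNormalOn_of_regular {X : Type*} [TopologicalSpace X] [CompactSpace X]
    {A : Subalgebra ℂ C(X, ℂ)} (hA : IsClosed (A : Set C(X, ℂ))) (hnat : IsNatural A)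
    (hreg : ∀ (x : X) (F : Set X), IsClosed F → x ∉ F → ∃ f ∈ A, f x ≠ 0 ∧ ∀ y ∈ F, f y = 0) :
    IsNormalOn A := by
  intro K₀ K₁ h₀ h₁ hd
  have : CompleteSpace A := hA.completeSpace_coe
  -- A proper sum would lie in the kernel of evaluation at some `x`. But `x` misses one of the two
  -- sets, and `hreg` gives a function vanishing on that set and not at `x`. Writing `1 = f + g` in
  -- the sum then yields the separating function.
  have htop : vanishingIdeal A K₀ ⊔ vanishingIdeal A K₁ = ⊤ := by
    by_contra hne
    obtain ⟨M, hM, hle⟩ := Ideal.exists_le_maximal _ hne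
    obtain ⟨x, hx⟩ := hnat.2 (WeakDual.CharacterSpace.equivAlgHom M.toCharacterSpace)
    have hz : ∀ f (hf : f ∈ A), (⟨f, hf⟩ : A) ∈ M → f x = 0 := by
      intro f hf hfM
      have := Ideal.toCharacterSpace_apply_eq_zero_of_mem M hfM
      exact (congrArg (fun φ : A →ₐ[ℂ] ℂ => φ ⟨f, hf⟩) hx).trans this
    have key : ∀ E : Set X, IsClosed E → x ∉ E → vanishingIdeal A E ≤ M → False := by
      intro E hE hxE hEM
      obtain ⟨f, hf, hfx, hfE⟩ := hreg x E hE hxE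
      exact hfx (hz f hf (hEM hfE))
    by_cases hx0 : x ∈ K₀
    · exact key K₁ h₁ (Set.disjoint_left.1 hd hx0) (le_sup_right.trans hle)
    · exact key K₀ h₀ hx0 (le_sup_left.trans hle)
  obtain ⟨f, hf, g, hg, hfg⟩ := Submodule.mem_sup.1 (htop.symm ▸ Submodule.mem_top :
    (1 : A) ∈ vanishingIdeal A K₀ ⊔ vanishingIdeal A K₁)
  refine ⟨f, f.2, fun x hx => ?_, hf⟩
  have h1 : (f : C(X, ℂ)) x + (g : C(X, ℂ)) x = 1 := by
    have := congrArg (fun h : A => (h : C(X, ℂ)) x) hfg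
    simpa using this
  rwa [hg x hx, add_zero] at h1

/-! ### The sector and the function `exp (1 / z²)` -/

/-- A smooth cutoff, away from the origin, to the sector `|z| / 10 < Re z`. -/
noncomputable def sectorCutoff (z : ℂ) : ℂ :=
  (Real.smoothTransition (2 * (z.re * ‖z‖⁻¹) - 1 / 5) : ℝ)

lemma sectorCutoff_eq_zero {z : ℂ} (hz : z.re ≤ ‖z‖ / 10) : sectorCutoff z = 0 := by
  rw [sectorCutoff, Real.smoothTransition.zero_of_nonpos, ofReal_zero]
  rcases eq_or_ne z 0 with rfl | h
  · norm_num
  · have h0 : 0 < ‖z‖ := norm_pos_iff.2 h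
    have : z.re * ‖z‖⁻¹ ≤ 1 / 10 := by
      rw [← div_eq_mul_inv, div_le_iff₀ h0]; linarith
    linarith

lemma sectorCutoff_eq_one {z : ℂ} (h0 : z ≠ 0) (hz : 3 / 5 * ‖z‖ ≤ z.re) : sectorCutoff z = 1 := by
  rw [sectorCutoff, Real.smoothTransition.one_of_one_le, ofReal_one]
  have h0 : 0 < ‖z‖ := norm_pos_iff.2 h0
  have : 3 / 5 ≤ z.re * ‖z‖⁻¹ := by
    rw [← div_eq_mul_inv, le_div_iff₀ h0]; linarith
  linarith

lemma norm_sectorCutoff_le_one (z : ℂ) : ‖sectorCutoff z‖ ≤ 1 := by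
  rw [sectorCutoff, norm_real, Real.norm_of_nonneg (Real.smoothTransition.nonneg _)]
  exact Real.smoothTransition.le_one _

lemma contDiffAt_sectorCutoff {z : ℂ} (hz : z ≠ 0) : ContDiffAt ℝ 1 sectorCutoff z := by
  have h1 : ContDiffAt ℝ 1 (fun w : ℂ => 2 * (w.re * ‖w‖⁻¹) - 1 / 5) z :=
    (contDiffAt_const.mul (reCLM.contDiff.contDiffAt.mul
      ((contDiffAt_norm ℝ hz).inv (norm_ne_zero_iff.2 hz)))).sub contDiffAt_const
  have h2 : ContDiffAt ℝ 1 (fun w : ℂ => Real.smoothTransition (2 * (w.re * ‖w‖⁻¹) - 1 / 5)) z :=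
    (Real.smoothTransition.contDiff (n := 1)).contDiffAt.comp z h1
  exact ofRealCLM.contDiff.contDiffAt.comp z h2

lemma norm_fderiv_re_mul_inv_norm_le {z : ℂ} (hz : z ≠ 0) (v : ℂ) :
    ‖fderiv ℝ (fun w : ℂ => 2 * (w.re * ‖w‖⁻¹) - 1 / 5) z v‖ ≤ 4 * ‖z‖⁻¹ * ‖v‖ := by
  have h0 : 0 < ‖z‖ := norm_pos_iff.2 hz
  have hn : HasFDerivAt (fun w : ℂ => ‖w‖) (fderiv ℝ (fun w : ℂ => ‖w‖) z) z :=
    ((contDiffAt_norm ℝ hz (n := 1)).differentiableAt (by norm_num)).hasFDerivAt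
  have hN : ‖fderiv ℝ (fun w : ℂ => ‖w‖) z‖ ≤ 1 := by
    simpa using norm_fderiv_le_of_lipschitz ℝ (x₀ := z) lipschitzWith_one_norm
  have hi := (hasDerivAt_inv h0.ne').comp_hasFDerivAt z hn
  have h := (((reCLM.hasFDerivAt (x := z)).mul hi).const_mul 2).sub_const (1 / 5)
  have h' : HasFDerivAt (fun w : ℂ => 2 * (w.re * ‖w‖⁻¹) - 1 / 5) _ z := h
  rw [h'.fderiv]
  simp only [smul_apply, add_apply, smul_eq_mul, reCLM_apply, Function.comp]
  have e1 : |v.re| ≤ ‖v‖ := abs_re_le_norm v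
  have e2 : |z.re| ≤ ‖z‖ := abs_re_le_norm z
  have e3 : ‖fderiv ℝ (fun w : ℂ => ‖w‖) z v‖ ≤ ‖v‖ := by
    simpa using (fderiv ℝ (fun w : ℂ => ‖w‖) z).le_of_opNorm_le hN v
  have e4 : |z.re * (-(‖z‖ ^ 2)⁻¹ * fderiv ℝ (fun w : ℂ => ‖w‖) z v)| ≤ ‖z‖⁻¹ * ‖v‖ := by
    rw [abs_mul, abs_mul, abs_neg, abs_of_pos (by positivity : 0 < (‖z‖ ^ 2)⁻¹)]
    calc _ ≤ ‖z‖ * ((‖z‖ ^ 2)⁻¹ * ‖v‖) := by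
          gcongr
          exact e3
      _ = _ := by field_simp
  have e5 : |‖z‖⁻¹ * v.re| ≤ ‖z‖⁻¹ * ‖v‖ := by
    rw [abs_mul, abs_of_pos (inv_pos.2 h0)]; gcongr
  rw [Real.norm_eq_abs, abs_mul, abs_of_pos (by norm_num : (0 : ℝ) < 2)]
  have := abs_add_le (z.re * (-(‖z‖ ^ 2)⁻¹ * fderiv ℝ (fun w : ℂ => ‖w‖) z v)) (‖z‖⁻¹ * v.re)
  linarith

/-- The cutoff depends only on the direction of `z`, so its derivatives scale like `1 / ‖z‖`. -/
lemma exists_bound_dbar_sectorCutoff :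
    ∃ C : ℝ, 0 < C ∧ ∀ z, z ≠ 0 → ‖dbar sectorCutoff z‖ ≤ C * ‖z‖⁻¹ := by
  obtain ⟨C, hC0, hC⟩ := exists_bound_deriv_smoothTransition
  refine ⟨C * 4, by positivity, fun z hz => ?_⟩
  have h1 : DifferentiableAt ℝ (fun w : ℂ => 2 * (w.re * ‖w‖⁻¹) - 1 / 5) z :=
    ((contDiffAt_const.mul (reCLM.contDiff.contDiffAt.mul
      ((contDiffAt_norm ℝ hz).inv (norm_ne_zero_iff.2 hz)))).sub
      contDiffAt_const : ContDiffAt ℝ 1 _ z).differentiableAt (by norm_num)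
  have h2 := dbar_ofReal_comp (differentiable_smoothTransition _) h1
  change ‖dbar (fun w : ℂ => ((Real.smoothTransition (2 * (w.re * ‖w‖⁻¹) - 1 / 5) : ℝ) : ℂ)) z‖ ≤ _
  rw [h2, norm_mul, norm_real, norm_div]
  have e1 := norm_fderiv_re_mul_inv_norm_le hz 1
  have e2 := norm_fderiv_re_mul_inv_norm_le hz I
  rw [norm_one, mul_one] at e1
  rw [norm_I, mul_one] at e2
  rw [mul_assoc]
  gcongr
  · exact hC _
  · rw [div_le_iff₀ (by simp)]
    refine (norm_add_le _ _).trans ?_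
    rw [norm_mul, norm_I, one_mul, norm_real, norm_real]
    simp only [Complex.norm_ofNat]
    linarith

lemma dbar_sectorCutoff_eq_zero {z : ℂ} (hz : z ≠ 0)
    (h : z.re ≤ ‖z‖ / 10 ∨ 3 / 5 * ‖z‖ ≤ z.re) : dbar sectorCutoff z = 0 := by
  have h0 : 0 < ‖z‖ := norm_pos_iff.2 hz
  have h1 : DifferentiableAt ℝ (fun w : ℂ => 2 * (w.re * ‖w‖⁻¹) - 1 / 5) z :=
    ((contDiffAt_const.mul (reCLM.contDiff.contDiffAt.mul
      ((contDiffAt_norm ℝ hz).inv (norm_ne_zero_iff.2 hz)))).sub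
      contDiffAt_const : ContDiffAt ℝ 1 _ z).differentiableAt (by norm_num)
  have h2 := dbar_ofReal_comp (differentiable_smoothTransition _) h1
  change dbar (fun w : ℂ => ((Real.smoothTransition (2 * (w.re * ‖w‖⁻¹) - 1 / 5) : ℝ) : ℂ)) z = 0
  rw [h2]
  have : deriv Real.smoothTransition (2 * (z.re * ‖z‖⁻¹) - 1 / 5) = 0 := by
    rw [← div_eq_mul_inv]
    rcases h with h | h
    · refine deriv_smoothTransition_eq_zero_of_nonpos ?_
      have : z.re / ‖z‖ ≤ 1 / 10 := by rw [div_le_iff₀ h0]; linarith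
      linarith
    · refine deriv_smoothTransition_eq_zero_of_one_le ?_
      have : 3 / 5 ≤ z.re / ‖z‖ := by rw [le_div_iff₀ h0]; linarith
      linarith
  rw [this]; simp

/-- The function `exp (1 / z²)`, bounded on the sides of the sector and unbounded within. -/
noncomputable def expInvSq (z : ℂ) : ℂ := Complex.exp ((z ^ 2)⁻¹)

lemma differentiableAt_expInvSq {z : ℂ} (hz : z ≠ 0) : DifferentiableAt ℂ expInvSq z :=
  ((differentiableAt_id.pow 2).inv (pow_ne_zero 2 hz)).cexp

lemma measurable_expInvSq : Measurable expInvSq := by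
  unfold expInvSq; fun_prop

lemma norm_expInvSq_le_exp (z : ℂ) : ‖expInvSq z‖ ≤ Real.exp ((‖z‖ ^ 2)⁻¹) := by
  rw [expInvSq, norm_exp]
  refine Real.exp_le_exp.2 ((re_le_norm _).trans ?_)
  rw [norm_inv, norm_pow]

lemma norm_expInvSq_le_of_le {z : ℂ} {r : ℝ} (hr : 0 < r) (hz : r ≤ ‖z‖) :
    ‖expInvSq z‖ ≤ Real.exp ((r ^ 2)⁻¹) := by
  refine (norm_expInvSq_le_exp z).trans (Real.exp_le_exp.2 ?_)
  gcongr

/-- In these directions `Re z²` is at most `-‖z‖² / 4`, so `exp (1 / z²)` decays rapidly at `0`. The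
linear bound kept here is just what cancels the `1 / ‖z‖` growth of `dbar sectorCutoff`. -/
lemma norm_expInvSq_le_of_re_le {z : ℂ} (hz : z ≠ 0) (h0 : 0 ≤ z.re)
    (h : z.re ≤ 3 / 5 * ‖z‖) : ‖expInvSq z‖ ≤ 4 * ‖z‖ := by
  have hp : 0 < ‖z‖ := norm_pos_iff.2 hz
  have h1 : ((z ^ 2)⁻¹).re ≤ -(1 / (4 * ‖z‖ ^ 2)) := by
    have e1 : z.re * z.re + z.im * z.im = ‖z‖ ^ 2 := by
      rw [← normSq_eq_norm_sq, normSq_apply]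
    have e2 : (z ^ 2).re = 2 * z.re ^ 2 - ‖z‖ ^ 2 := by
      rw [sq, mul_re]; linarith
    have e3 : z.re ^ 2 ≤ (3 / 5 * ‖z‖) ^ 2 := by gcongr
    rw [inv_re, e2, normSq_eq_norm_sq, norm_pow, div_le_iff₀ (by positivity)]
    have : -(1 / (4 * ‖z‖ ^ 2)) * (‖z‖ ^ 2) ^ 2 = - (‖z‖ ^ 2 / 4) := by field_simp
    rw [this]; nlinarith
  rw [expInvSq, norm_exp]
  set t := 1 / (4 * ‖z‖ ^ 2) with ht
  have ht0 : 0 < t := by positivity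
  calc Real.exp _ ≤ Real.exp (-t) := Real.exp_le_exp.2 h1
    _ ≤ 1 / (1 + t) := by
      rw [Real.exp_neg, ← one_div]
      have := Real.add_one_le_exp t
      exact one_div_le_one_div_of_le (by positivity) (by linarith)
    _ ≤ 4 * ‖z‖ := by
      rw [div_le_iff₀ (by positivity), ht]
      have : 4 * ‖z‖ * (1 + 1 / (4 * ‖z‖ ^ 2)) = 4 * ‖z‖ + ‖z‖⁻¹ := by field_simp
      rw [this]
      have h5 : ‖z‖ * ‖z‖⁻¹ = 1 := mul_inv_cancel₀ hp.ne'
      have h6 : 0 < ‖z‖⁻¹ := inv_pos.2 hp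
      by_contra! hlt
      nlinarith

/-- The cutoff to a bounded sector. -/
noncomputable def baseCutoff (z : ℂ) : ℂ := sectorCutoff z * discBump 0 1 z

lemma norm_discBump_le_one (c : ℂ) (r : ℝ) (z : ℂ) : ‖discBump c r z‖ ≤ 1 := norm_bump_le_one _

lemma norm_one_sub_discBump_le_one (c : ℂ) (r : ℝ) (z : ℂ) : ‖1 - discBump c r z‖ ≤ 1 :=
  norm_one_sub_bump_le_one _

lemma norm_baseCutoff_le_one (z : ℂ) : ‖baseCutoff z‖ ≤ 1 := by
  rw [baseCutoff, norm_mul]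
  exact mul_le_one₀ (norm_sectorCutoff_le_one z) (norm_nonneg _) (norm_discBump_le_one _ _ _)

lemma contDiffAt_baseCutoff {z : ℂ} (hz : z ≠ 0) : ContDiffAt ℝ 1 baseCutoff z :=
  (contDiffAt_sectorCutoff hz).mul (contDiff_discBump 0 1).contDiffAt

lemma differentiableAt_baseCutoff {z : ℂ} (hz : z ≠ 0) : DifferentiableAt ℝ baseCutoff z :=
  (contDiffAt_baseCutoff hz).differentiableAt (by norm_num)

lemma mem_sector_of_baseCutoff_ne_zero {z : ℂ} (hz : baseCutoff z ≠ 0) :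
    ‖z‖ ≤ 3 / 2 ∧ ‖z‖ / 10 ≤ z.re := by
  constructor
  · by_contra! h
    refine hz ?_
    rw [baseCutoff, discBump_eq_zero one_pos (by rw [sub_zero]; linarith), mul_zero]
  · by_contra! h
    refine hz ?_
    rw [baseCutoff, sectorCutoff_eq_zero h.le, zero_mul]

lemma baseCutoff_eq_one {z : ℂ} {a : ℝ} (ha : 0 < a) (ha' : a ≤ 1 / 2) (hz : ‖z - a‖ ≤ a / 4) :
    baseCutoff z = 1 := by
  have h1 : |z.re - a| ≤ a / 4 := by
    simpa using (abs_re_le_norm (z - a)).trans hz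
  have h2 : ‖z‖ ≤ 5 / 4 * a := by
    have := norm_add_le (z - a) (a : ℂ)
    rw [sub_add_cancel, norm_real, Real.norm_of_nonneg ha.le] at this
    linarith
  have h3 := (abs_le.1 h1).1
  have h0 : z ≠ 0 := by
    rintro rfl
    rw [zero_re] at h3; linarith
  rw [baseCutoff, sectorCutoff_eq_one h0 (by linarith), discBump_eq_one one_pos, one_mul]
  rw [sub_zero]; linarith

lemma dbar_baseCutoff {z : ℂ} (hz : z ≠ 0) : dbar baseCutoff z =
    sectorCutoff z * dbar (discBump 0 1) z + discBump 0 1 z * dbar sectorCutoff z :=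
  dbar_mul ((contDiffAt_sectorCutoff hz).differentiableAt (by norm_num))
    (differentiable_discBump 0 1 z)

lemma dbar_baseCutoff_eq_zero {z : ℂ} (hz : 2 ≤ ‖z‖) : dbar baseCutoff z = 0 := by
  refine dbar_eq_zero_of_eventually_const (c := 0) ?_
  filter_upwards [continuous_norm.continuousAt.eventually (lt_mem_nhds
    (show (3 / 2 : ℝ) < ‖z‖ by linarith))] with w hw
  by_contra h
  exact absurd (mem_sector_of_baseCutoff_ne_zero h).1 (not_le.2 hw)

/-- The outer arc stays away from the singularity at `0`; along the sides the decay of `expInvSq`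
compensates the blow-up of the gradient. The axis, where `expInvSq` explodes, contributes nothing
near `0` because the cutoff is constant there. -/
lemma exists_bound_dbar_baseCutoff : ∃ C : ℝ, 0 < C ∧
    ∀ z, z ≠ 0 → ‖expInvSq z * dbar baseCutoff z‖ ≤ C := by
  obtain ⟨C₁, hC₁, h₁⟩ := exists_bound_dbar_bump
  obtain ⟨C₂, hC₂, h₂⟩ := exists_bound_dbar_sectorCutoff
  refine ⟨Real.exp 1 * C₁ + C₂ * 4, by positivity, fun z hz => ?_⟩
  have hp : 0 < ‖z‖ := norm_pos_iff.2 hz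
  have e1 : ‖expInvSq z * dbar (discBump 0 1) z‖ ≤ Real.exp 1 * C₁ := by
    rcases le_total ‖z‖ 1 with h | h
    · rw [dbar_discBump_eq_zero one_pos (Or.inl (by simpa using h)), mul_zero, norm_zero]
      positivity
    · rw [norm_mul]
      gcongr
      · simpa using norm_expInvSq_le_of_le one_pos h
      · rw [dbar_discBump]; simpa using h₁ z
  have e2 : ‖expInvSq z * dbar sectorCutoff z‖ ≤ C₂ * 4 := by
    by_cases h : z.re ≤ ‖z‖ / 10 ∨ 3 / 5 * ‖z‖ ≤ z.re
    · rw [dbar_sectorCutoff_eq_zero hz h, mul_zero, norm_zero]; positivity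
    · push Not at h
      have h3 := norm_expInvSq_le_of_re_le hz (by linarith [h.1]) h.2.le
      rw [norm_mul]
      calc _ ≤ (4 * ‖z‖) * (C₂ * ‖z‖⁻¹) := by
            gcongr
            exact h₂ z hz
        _ = C₂ * 4 := by field_simp
  rw [dbar_baseCutoff hz, mul_add]
  refine (norm_add_le _ _).trans (add_le_add ?_ ?_)
  · rw [mul_left_comm, norm_mul]
    exact (mul_le_of_le_one_left (norm_nonneg _) (norm_sectorCutoff_le_one z)).trans e1
  · rw [mul_left_comm, norm_mul]
    exact (mul_le_of_le_one_left (norm_nonneg _) (norm_discBump_le_one _ _ _)).trans e2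

/-- On the support of `dbar baseCutoff`, `z / (z - a)` is bounded independently of `a`. -/
lemma norm_div_sub_mul_dbar_baseCutoff_le {z : ℂ} {a : ℝ} (hz : z ≠ 0) (ha : 0 < a)
    (ha' : a ≤ 1 / 2) : ‖z / (z - a) * dbar baseCutoff z‖ ≤ 2 * ‖dbar baseCutoff z‖ := by
  rw [norm_mul]
  by_cases h0 : dbar baseCutoff z = 0
  · simp [h0]
  gcongr
  have hp : 0 < ‖z‖ := norm_pos_iff.2 hz
  suffices h : ‖z‖ ≤ 2 * ‖z - a‖ by
    rw [norm_div]
    exact div_le_of_le_mul₀ (norm_nonneg _) (by norm_num) h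
  -- The derivative lives on the outer arc or on the sides, both of which stay away from `a` on the
  -- axis at a distance comparable to `‖z‖`.
  have hcase : 1 ≤ ‖z‖ ∨ z.re ≤ 3 / 5 * ‖z‖ := by
    by_contra! h
    refine h0 ?_
    rw [dbar_baseCutoff hz, dbar_sectorCutoff_eq_zero hz (Or.inr h.2.le),
      dbar_discBump_eq_zero one_pos (Or.inl (by simpa using h.1.le))]
    simp
  rcases hcase with h | h
  · have := norm_sub_norm_le z (a : ℂ)
    rw [norm_real, Real.norm_of_nonneg ha.le] at this
    linarith
  · have e1 : ‖z - a‖ ^ 2 = ‖z‖ ^ 2 - 2 * a * z.re + a ^ 2 := by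
      rw [← normSq_eq_norm_sq, ← normSq_eq_norm_sq, normSq_apply, normSq_apply]
      simp; ring
    refine abs_le_of_sq_le_sq' ?_ (by positivity) |>.2
    rw [mul_pow, e1]
    nlinarith [sq_nonneg (a - 3 / 5 * ‖z‖), mul_le_mul_of_nonneg_left h ha.le]

/-! ### Cutoffs that vanish on discs -/

/-- The product of the cutoffs that vanish on the discs indexed by `s`. -/
noncomputable def holeCutoff {ι : Type*} (ctr : ι → ℂ) (rad : ι → ℝ) (s : Finset ι) (z : ℂ) : ℂ :=
  ∏ i ∈ s, (1 - discBump (ctr i) (rad i) z)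

section holeCutoff

variable {ι : Type*} (ctr : ι → ℂ) (rad : ι → ℝ)

lemma contDiff_holeCutoff (s : Finset ι) : ContDiff ℝ 1 (holeCutoff ctr rad s) :=
  contDiff_prod fun i _ => contDiff_const.sub (contDiff_discBump (ctr i) (rad i))

lemma norm_holeCutoff_le_one (s : Finset ι) (z : ℂ) : ‖holeCutoff ctr rad s z‖ ≤ 1 := by
  rw [holeCutoff, norm_prod]
  exact Finset.prod_le_one (fun _ _ => norm_nonneg _) fun i _ => norm_one_sub_discBump_le_one _ _ _

lemma holeCutoff_eq_zero {s : Finset ι} {i : ι} (hi : i ∈ s) (hr : 0 < rad i) {z : ℂ}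
    (hz : ‖z - ctr i‖ ≤ rad i) : holeCutoff ctr rad s z = 0 :=
  Finset.prod_eq_zero hi (by rw [discBump_eq_one hr hz, sub_self])

/-- By the Leibniz rule, each term has one differentiated factor and other factors of modulus at
most `1`. Overlaps between discs therefore do no harm. -/
lemma norm_dbar_holeCutoff_le (s : Finset ι) (z : ℂ) :
    ‖dbar (holeCutoff ctr rad s) z‖ ≤ ∑ i ∈ s, ‖dbar (discBump (ctr i) (rad i)) z‖ := by
  classical
  induction s using Finset.induction_on with
  | empty =>
    have : dbar (holeCutoff ctr rad ∅) z = 0 :=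
      dbar_eq_zero_of_eventually_const (c := 1) (Filter.Eventually.of_forall fun w => by
        simp [holeCutoff])
    simp [this]
  | insert i s hi ih =>
    have e : holeCutoff ctr rad (insert i s) =
        fun w => (1 - discBump (ctr i) (rad i) w) * holeCutoff ctr rad s w := by
      ext w; simp [holeCutoff, hi]
    rw [e, dbar_mul ((differentiable_discBump _ _ z).const_sub 1)
      ((contDiff_holeCutoff ctr rad s).differentiable (by norm_num) z), dbar_const_sub,
      Finset.sum_insert hi, add_comm]
    refine (norm_add_le _ _).trans (add_le_add ?_ ?_)
    · rw [norm_mul, norm_neg]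
      exact mul_le_of_le_one_left (norm_nonneg _) (norm_holeCutoff_le_one _ _ _ _)
    · rw [norm_mul]
      exact (mul_le_of_le_one_left (norm_nonneg _) (norm_one_sub_discBump_le_one _ _ _)).trans ih

lemma holeCutoff_eventually_eq_one {s : Finset ι} (hr : ∀ i, 0 < rad i)
    (h : ∀ i, 2 * rad i < ‖ctr i‖) : ∀ᶠ z in 𝓝 (0 : ℂ), holeCutoff ctr rad s z = 1 := by
  have h1 : ∀ i ∈ s, ∀ᶠ z in 𝓝 (0 : ℂ), discBump (ctr i) (rad i) z = 0 := by
    intro i _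
    have : Filter.Tendsto (fun z => ‖z - ctr i‖) (𝓝 0) (𝓝 ‖(0 : ℂ) - ctr i‖) :=
      (continuous_id.sub continuous_const).norm.tendsto 0
    rw [zero_sub, norm_neg] at this
    filter_upwards [this.eventually (lt_mem_nhds (h i))] with z hz
    exact discBump_eq_zero (hr i) (by linarith [hr i])
  filter_upwards [(Finset.eventually_all s).2 h1] with z hz
  exact Finset.prod_eq_one fun i hi => by rw [hz i hi, sub_zero]

end holeCutoff

/-! ### Disc systems and the nonvanishing of the pairing -/

/-- A system of open discs, at positive distance from the origin and with finite total radius when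
weighted with the size of `expInvSq`; one of the discs is centred at a given point `a > 0`. -/
structure DiscSystem where
  ι : Type
  ctr : ι → ℂ
  rad : ι → ℝ
  wt : ι → ℝ
  rad_pos : ∀ i, 0 < rad i
  two_mul_rad_lt : ∀ i, 2 * rad i < ‖ctr i‖
  norm_le_wt : ∀ i z, ‖z - ctr i‖ ≤ 2 * rad i → ‖expInvSq z‖ ≤ wt i
  total : ℝ
  sum_le_total : ∀ s : Finset ι, ∑ i ∈ s, rad i * wt i ≤ total
  a : ℝ
  a_pos : 0 < a
  a_le : a ≤ 1 / 2
  i₀ : ι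
  ctr_i₀ : ctr i₀ = a
  rad_i₀ : rad i₀ = a / 8

/-- The closed sector from which the discs are removed. -/
def closedSector : Set ℂ := {z | ‖z‖ ≤ 3 / 2 ∧ ‖z‖ / 10 ≤ z.re}

lemma isClosed_closedSector : IsClosed closedSector :=
  (isClosed_le continuous_norm continuous_const).inter
    (isClosed_le (continuous_norm.div_const 10) continuous_re)

lemma isCompact_closedSector : IsCompact closedSector :=
  (isCompact_closedBall (0 : ℂ) (3 / 2)).of_isClosed_subset isClosed_closedSector
    fun _ hz => mem_closedBall_zero_iff.2 hz.1

/-- The size of the pairing of `z / (z - a)` with the functional of the system. -/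
noncomputable def pairing (a : ℝ) : ℂ :=
  (∫ z, z / (z - a) * expInvSq z * dbar baseCutoff z) - a * expInvSq a * ∫ z, dbar bump z / z

lemma ae_ne_zero : ∀ᵐ z : ℂ, z ≠ 0 := by simp [ae_iff]

/-- Dominating function for `dbar baseCutoff`. -/
lemma norm_mul_dbar_baseCutoff_le_indicator {C₀ : ℝ}
    (hC₀ : ∀ z, z ≠ 0 → ‖expInvSq z * dbar baseCutoff z‖ ≤ C₀) {z : ℂ} (hz : z ≠ 0) :
    ‖expInvSq z * dbar baseCutoff z‖ ≤
      (Metric.closedBall (0 : ℂ) 2).indicator (fun _ => C₀) z := by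
  by_cases h : z ∈ Metric.closedBall (0 : ℂ) 2
  · rw [Set.indicator_of_mem h]; exact hC₀ z hz
  · rw [Set.indicator_of_notMem h]
    rw [mem_closedBall_zero_iff, not_le] at h
    rw [dbar_baseCutoff_eq_zero h.le, mul_zero, norm_zero]

lemma integrable_indicator_closedBall (c : ℂ) (r C : ℝ) :
    Integrable ((Metric.closedBall c r).indicator fun _ => C) :=
  (integrable_indicator_iff Metric.isClosed_closedBall.measurableSet).2
    (integrableOn_const (measure_closedBall_lt_top.ne))

lemma integral_indicator_closedBall (c : ℂ) {r : ℝ} (hr : 0 ≤ r) (C : ℝ) :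
    ∫ z, (Metric.closedBall c r).indicator (fun _ => C) z = Real.pi * r ^ 2 * C := by
  rw [integral_indicator Metric.isClosed_closedBall.measurableSet, setIntegral_const, smul_eq_mul,
    measureReal_def, Complex.volume_closedBall, ENNReal.toReal_mul, ENNReal.toReal_pow,
    ENNReal.toReal_ofReal hr]
  simp only [ENNReal.coe_toReal, NNReal.coe_real_pi]
  ring

lemma norm_mul_dbar_le_two_mul {C₀ : ℝ} {a : ℝ} (ha : 0 < a) (ha' : a ≤ 1 / 2)
    (hC₀ : ∀ z, z ≠ 0 → ‖expInvSq z * dbar baseCutoff z‖ ≤ C₀) {z : ℂ} (hz : z ≠ 0) :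
    ‖z / (z - a) * expInvSq z * dbar baseCutoff z‖ ≤
      (Metric.closedBall (0 : ℂ) 2).indicator (fun _ => 2 * C₀) z := by
  have h1 := norm_div_sub_mul_dbar_baseCutoff_le hz ha ha'
  have h2 := norm_mul_dbar_baseCutoff_le_indicator hC₀ hz
  have e : z / (z - a) * expInvSq z * dbar baseCutoff z =
    expInvSq z * (z / (z - a) * dbar baseCutoff z) := by ring
  rw [Set.indicator_const_mul, e, norm_mul]
  rw [norm_mul] at h2
  calc _ ≤ ‖expInvSq z‖ * (2 * ‖dbar baseCutoff z‖) := by gcongr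
    _ = 2 * (‖expInvSq z‖ * ‖dbar baseCutoff z‖) := by ring
    _ ≤ _ := by gcongr

lemma integrable_mul_dbar_baseCutoff {a : ℝ} (ha : 0 < a) (ha' : a ≤ 1 / 2) :
    Integrable fun z : ℂ => z / (z - a) * expInvSq z * dbar baseCutoff z := by
  obtain ⟨C₀, -, hC₀⟩ := exists_bound_dbar_baseCutoff
  refine Integrable.mono' (integrable_indicator_closedBall 0 2 (2 * C₀)) ?_ ?_
  · have h1 := measurable_expInvSq
    have h2 := measurable_dbar baseCutoff
    exact ((((measurable_id.div (measurable_id.sub_const _)).mul h1).mul h2)).aestronglyMeasurable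
  · filter_upwards [ae_ne_zero] with z hz
    exact norm_mul_dbar_le_two_mul ha ha' hC₀ hz

/-- For small `a` the pairing does not vanish, as `expInvSq a` is large. -/
lemma exists_pairing_ne_zero : ∃ a : ℝ, 0 < a ∧ a ≤ 1 / 2 ∧ pairing a ≠ 0 := by
  obtain ⟨C₀, hC, hC₀⟩ := exists_bound_dbar_baseCutoff
  set κ := ∫ z, dbar bump z / z with hκ
  have hκ0 : 0 < ‖κ‖ := norm_pos_iff.2 integral_dbar_bump_div_ne_zero
  set V := Real.pi * 2 ^ 2 * (2 * C₀) with hV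
  have hV0 : 0 < V := by positivity
  -- The area integral is at most `V` for every `a`, while the residue term is at least `‖κ‖ / a`,
  -- because `a * exp (1 / a²) ≥ 1 / a`. This choice gives `‖κ‖ / a ≥ 2 * V`.
  set a := min (1 / 2) (‖κ‖ / (2 * V)) with ha
  have ha0 : 0 < a := by positivity
  have ha1 : a ≤ 1 / 2 := min_le_left _ _
  have ha2 : a * (2 * V) ≤ ‖κ‖ := (le_div_iff₀ (by positivity)).1 (min_le_right _ _)
  refine ⟨a, ha0, ha1, fun h => ?_⟩
  rw [pairing, sub_eq_zero] at h
  have h1 : ‖∫ z, z / (z - a) * expInvSq z * dbar baseCutoff z‖ ≤ V := by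
    rw [hV, ← integral_indicator_closedBall 0 (by norm_num)]
    refine norm_integral_le_of_norm_le (integrable_indicator_closedBall 0 2 _) ?_
    filter_upwards [ae_ne_zero] with z hz
    exact norm_mul_dbar_le_two_mul ha0 ha1 hC₀ hz
  have h2 : 1 / a ≤ ‖(a : ℂ) * expInvSq a‖ := by
    rw [norm_mul, norm_real, Real.norm_of_nonneg ha0.le, expInvSq, norm_exp]
    have e : (((a : ℂ) ^ 2)⁻¹).re = (a ^ 2)⁻¹ := by
      rw [← ofReal_pow, ← ofReal_inv, ofReal_re]
    rw [e]
    have := Real.add_one_le_exp (a ^ 2)⁻¹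
    calc 1 / a = a * (a ^ 2)⁻¹ := by field_simp
      _ ≤ _ := by gcongr; linarith
  rw [h, norm_mul] at h1
  have h3 : 1 / a * ‖κ‖ ≤ V := (by gcongr : 1 / a * ‖κ‖ ≤ _).trans h1
  have h4 : 1 / a * ‖κ‖ = ‖κ‖ / a := by ring
  rw [h4, div_le_iff₀ ha0] at h3
  nlinarith

/-! ### Uniform estimates for the truncated cutoffs -/

namespace DiscSystem

variable (S : DiscSystem)

lemma wt_nonneg (i : S.ι) : 0 ≤ S.wt i :=
  (norm_nonneg _).trans (S.norm_le_wt i (S.ctr i) (by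
    rw [sub_self, norm_zero]; linarith [S.rad_pos i]))

/-- The closed sector without the discs indexed by `s`. -/
def trunc (s : Finset S.ι) : Set ℂ :=
  closedSector \ ⋃ i ∈ s, Metric.ball (S.ctr i) (S.rad i)

lemma isClosed_trunc (s : Finset S.ι) : IsClosed (S.trunc s) :=
  isClosed_closedSector.sdiff (isOpen_biUnion fun _ _ => Metric.isOpen_ball)

/-- The cutoff to `trunc s`. -/
noncomputable def cutoff (s : Finset S.ι) (z : ℂ) : ℂ :=
  baseCutoff z * holeCutoff S.ctr S.rad s z

lemma norm_cutoff_le_one (s : Finset S.ι) (z : ℂ) : ‖S.cutoff s z‖ ≤ 1 := by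
  rw [cutoff, norm_mul]
  exact mul_le_one₀ (norm_baseCutoff_le_one z) (norm_nonneg _) (norm_holeCutoff_le_one _ _ _ _)

lemma mem_trunc_of_cutoff_ne_zero {s : Finset S.ι} {z : ℂ} (hz : S.cutoff s z ≠ 0) :
    z ∈ S.trunc s := by
  refine ⟨mem_sector_of_baseCutoff_ne_zero (left_ne_zero_of_mul hz), fun h => ?_⟩
  obtain ⟨i, hi, hzi⟩ := Set.mem_iUnion₂.1 h
  exact right_ne_zero_of_mul hz
    (holeCutoff_eq_zero _ _ hi (S.rad_pos i) (mem_ball_iff_norm.1 hzi).le)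

lemma tsupport_cutoff_subset (s : Finset S.ι) : tsupport (S.cutoff s) ⊆ S.trunc s :=
  closure_minimal (fun _ hz => S.mem_trunc_of_cutoff_ne_zero hz) (S.isClosed_trunc s)

lemma contDiffAt_cutoff (s : Finset S.ι) {z : ℂ} (hz : z ≠ 0) : ContDiffAt ℝ 1 (S.cutoff s) z :=
  (contDiffAt_baseCutoff hz).mul (contDiff_holeCutoff _ _ s).contDiffAt

lemma differentiableAt_cutoff (s : Finset S.ι) {z : ℂ} (hz : z ≠ 0) :
    DifferentiableAt ℝ (S.cutoff s) z :=
  (S.contDiffAt_cutoff s hz).differentiableAt (by norm_num)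

/-- A function that dominates `expInvSq * dbar (cutoff s)`. -/
noncomputable def majorant (C₀ Cb : ℝ) (s : Finset S.ι) (z : ℂ) : ℝ :=
  (Metric.closedBall (0 : ℂ) 2).indicator (fun _ => C₀) z +
    ∑ i ∈ s, (Metric.closedBall (S.ctr i) (2 * S.rad i)).indicator
      (fun _ => S.wt i * (Cb / S.rad i)) z

lemma integrable_majorant (C₀ Cb : ℝ) (s : Finset S.ι) : Integrable (S.majorant C₀ Cb s) :=
  (integrable_indicator_closedBall _ _ _).add
    (integrable_finsetSum _ fun _ _ => integrable_indicator_closedBall _ _ _)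

/-- A disc of radius `r` contributes its area, of order `r²`, times a gradient of order `1 / r`
times its weight. The sum is thus controlled by the weighted total radius, whatever the finite set
`s`. -/
lemma integral_majorant_le {C₀ Cb : ℝ} (hCb : 0 ≤ Cb) (s : Finset S.ι) :
    ∫ z, S.majorant C₀ Cb s z ≤ Real.pi * 2 ^ 2 * C₀ + 4 * Real.pi * Cb * S.total := by
  unfold majorant
  rw [integral_add (integrable_indicator_closedBall _ _ _)
    (integrable_finsetSum _ fun _ _ => integrable_indicator_closedBall _ _ _),
    integral_finsetSum _ fun _ _ => integrable_indicator_closedBall _ _ _,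
    integral_indicator_closedBall _ (by norm_num)]
  gcongr
  calc _ = ∑ i ∈ s, 4 * Real.pi * Cb * (S.rad i * S.wt i) := by
        refine Finset.sum_congr rfl fun i _ => ?_
        have := S.rad_pos i
        rw [integral_indicator_closedBall _ (by positivity)]
        field_simp
        ring
    _ ≤ _ := by
        rw [← Finset.mul_sum]
        have := S.sum_le_total s
        gcongr

lemma norm_mul_dbar_cutoff_le {C₀ Cb : ℝ}
    (hC₀ : ∀ z, z ≠ 0 → ‖expInvSq z * dbar baseCutoff z‖ ≤ C₀)
    (hCb : ∀ z, ‖dbar bump z‖ ≤ Cb) (s : Finset S.ι) {z : ℂ} (hz : z ≠ 0) :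
    ‖expInvSq z * dbar (S.cutoff s) z‖ ≤ S.majorant C₀ Cb s z := by
  have e : dbar (S.cutoff s) z = baseCutoff z * dbar (holeCutoff S.ctr S.rad s) z +
      holeCutoff S.ctr S.rad s z * dbar baseCutoff z :=
    dbar_mul (differentiableAt_baseCutoff hz)
      ((contDiff_holeCutoff _ _ s).differentiable (by norm_num) z)
  rw [e, mul_add, add_comm, majorant]
  refine (norm_add_le _ _).trans (add_le_add ?_ ?_)
  · rw [mul_left_comm, norm_mul]
    exact (mul_le_of_le_one_left (norm_nonneg _) (norm_holeCutoff_le_one _ _ _ _)).trans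
      (norm_mul_dbar_baseCutoff_le_indicator hC₀ hz)
  · rw [mul_left_comm, norm_mul]
    refine (mul_le_of_le_one_left (norm_nonneg _) (norm_baseCutoff_le_one z)).trans ?_
    rw [norm_mul]
    refine (mul_le_mul_of_nonneg_left (norm_dbar_holeCutoff_le _ _ s z) (norm_nonneg _)).trans ?_
    rw [Finset.mul_sum]
    refine Finset.sum_le_sum fun i _ => ?_
    have hr := S.rad_pos i
    by_cases h : z ∈ Metric.closedBall (S.ctr i) (2 * S.rad i)
    · rw [Set.indicator_of_mem h]
      gcongr
      · exact S.wt_nonneg i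
      · exact S.norm_le_wt i z (mem_closedBall_iff_norm.1 h)
      · rw [dbar_discBump, norm_div, norm_real, Real.norm_of_nonneg hr.le]
        gcongr
        exact hCb _
    · rw [Set.indicator_of_notMem h]
      rw [mem_closedBall_iff_norm, not_le] at h
      rw [dbar_discBump_eq_zero hr (Or.inr (by linarith)), norm_zero, mul_zero]

/-- Removing more discs does not change the pairing. -/
lemma integral_mul_dbar_cutoff {s : Finset S.ι} (hs : S.i₀ ∈ s) :
    Integrable (fun z : ℂ => z / (z - S.a) * expInvSq z * dbar (S.cutoff s) z) ∧
      ∫ z : ℂ, z / (z - S.a) * expInvSq z * dbar (S.cutoff s) z = pairing S.a := by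
  have ha := S.a_pos
  have ha' := S.a_le
  have hr : 0 < S.a / 8 := by positivity
  set β := discBump S.a (S.a / 8) with hβ
  -- `θ` compares the full cutoff with the sector cutoff minus a bump at `a`. It vanishes near both
  -- singularities `0` and `a` of the integrand, so Cauchy's theorem removes it, and the bump yields
  -- the residue term of `pairing` by Cauchy's formula.
  set θ : ℂ → ℂ := fun z => baseCutoff z - β z - S.cutoff s z with hθ
  have hβz : ∀ z : ℂ, S.a / 4 ≤ ‖z - S.a‖ → β z = 0 := fun z hz =>
    discBump_eq_zero hr (by linarith)
  have hθ0 : ∀ᶠ z in 𝓝 (0 : ℂ), θ z = 0 := by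
    filter_upwards [Metric.ball_mem_nhds (0 : ℂ) (half_pos ha),
      holeCutoff_eventually_eq_one S.ctr S.rad (s := s) S.rad_pos S.two_mul_rad_lt] with z h1 h2
    have h3 := norm_sub_norm_le (S.a : ℂ) z
    rw [mem_ball_zero_iff] at h1
    rw [norm_real, Real.norm_of_nonneg ha.le, norm_sub_rev] at h3
    simp only [hθ, cutoff]
    rw [hβz z (by linarith), h2]; ring
  have hθa : ∀ᶠ z in 𝓝 (S.a : ℂ), θ z = 0 := by
    filter_upwards [Metric.ball_mem_nhds (S.a : ℂ) hr] with z hz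
    rw [mem_ball_iff_norm] at hz
    simp only [hθ, cutoff]
    rw [baseCutoff_eq_one ha ha' (by linarith), hβ, discBump_eq_one hr hz.le,
      holeCutoff_eq_zero _ _ hs (S.rad_pos _) (by rw [S.ctr_i₀, S.rad_i₀]; exact hz.le)]
    ring
  have hθC : ContDiff ℝ 1 θ := by
    rw [contDiff_iff_contDiffAt]
    intro z
    rcases eq_or_ne z 0 with rfl | hz
    · exact (contDiffAt_const (c := (0 : ℂ))).congr_of_eventuallyEq hθ0
    · exact ((contDiffAt_baseCutoff hz).sub (contDiff_discBump _ _).contDiffAt).sub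
        (S.contDiffAt_cutoff s hz)
  have hθc : HasCompactSupport θ := by
    refine HasCompactSupport.intro (isCompact_closedBall (0 : ℂ) 2) fun z hz => ?_
    rw [mem_closedBall_zero_iff, not_le] at hz
    have h1 : baseCutoff z = 0 := by
      by_contra h
      linarith [(mem_sector_of_baseCutoff_ne_zero h).1]
    have h2 := norm_sub_norm_le z (S.a : ℂ)
    rw [norm_real, Real.norm_of_nonneg ha.le] at h2
    simp only [hθ, cutoff]
    rw [h1, hβz z (by linarith)]; ring
  have hU : IsOpen ({0, (S.a : ℂ)}ᶜ : Set ℂ) := (Set.toFinite _).isClosed.isOpen_compl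
  have hsub : tsupport θ ⊆ ({0, (S.a : ℂ)}ᶜ : Set ℂ) := by
    intro z hz hz'
    rcases hz' with rfl | rfl
    · exact notMem_tsupport_iff_eventuallyEq.2 hθ0 hz
    · exact notMem_tsupport_iff_eventuallyEq.2 hθa hz
  have hdiff : DifferentiableOn ℂ (fun z => z / (z - S.a) * expInvSq z)
      ({0, (S.a : ℂ)}ᶜ : Set ℂ) := by
    intro z hz
    simp only [Set.mem_compl_iff, Set.mem_insert_iff, Set.mem_singleton_iff, not_or] at hz
    have h1 : DifferentiableAt ℂ (fun w : ℂ => w / (w - S.a)) z :=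
      differentiableAt_fun_id.fun_div (differentiableAt_fun_id.sub_const _) (sub_ne_zero.2 hz.2)
    exact (h1.mul (differentiableAt_expInvSq hz.1)).differentiableWithinAt
  have hD := integral_mul_dbar_eq_zero hU hdiff hθC hθc hsub
  have hDi := integrable_mul_dbar hU hdiff.continuousOn hθC hθc hsub
  have hball : DifferentiableOn ℂ (fun z => z * expInvSq z)
      (Metric.ball (S.a : ℂ) (2 * (S.a / 8))) := by
    intro z hz
    refine (differentiableAt_id.mul (differentiableAt_expInvSq ?_)).differentiableWithinAt
    rintro rfl
    rw [mem_ball_iff_norm, zero_sub, norm_neg, norm_real, Real.norm_of_nonneg ha.le] at hz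
    linarith
  obtain ⟨hBi, hB⟩ := integral_div_sub_mul_dbar_discBump hr hball
  have hAi := integrable_mul_dbar_baseCutoff ha ha'
  have hae : (fun z : ℂ => z / (z - S.a) * expInvSq z * dbar (S.cutoff s) z) =ᵐ[volume]
      fun z => (z / (z - S.a) * expInvSq z * dbar baseCutoff z -
        z * expInvSq z / (z - S.a) * dbar β z) -
        z / (z - S.a) * expInvSq z * dbar θ z := by
    filter_upwards [ae_ne_zero] with z hz
    have e : dbar θ z = dbar baseCutoff z - dbar β z - dbar (S.cutoff s) z := by
      rw [hθ, dbar_sub ((differentiableAt_baseCutoff hz).fun_sub (differentiable_discBump _ _ z))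
        (S.differentiableAt_cutoff s hz),
        dbar_sub (differentiableAt_baseCutoff hz) (differentiable_discBump _ _ z)]
    rw [e]; ring
  refine ⟨((hAi.sub hBi).sub hDi).congr hae.symm, ?_⟩
  rw [integral_congr_ae hae]
  refine (integral_sub (hAi.sub hBi) hDi).trans ?_
  rw [hD, sub_zero]
  refine (integral_sub hAi hBi).trans ?_
  rw [hB, pairing]

/-- The main estimate: a function that is holomorphic near `trunc s` and small near `0` is not close
to `z / (z - a)`. -/
lemma norm_pairing_le {C₀ Cb : ℝ} (hCb0 : 0 ≤ Cb)
    (hC₀ : ∀ z, z ≠ 0 → ‖expInvSq z * dbar baseCutoff z‖ ≤ C₀)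
    (hCb : ∀ z, ‖dbar bump z‖ ≤ Cb) {s : Finset S.ι} (hs : S.i₀ ∈ s) {q : ℂ → ℂ} {U : Set ℂ}
    (hU : IsOpen U) (hq : DifferentiableOn ℂ q U) (hsU : S.trunc s ⊆ U) {δ δ' ρ : ℝ}
    (hρ : 0 < ρ) (hρa : 3 * ρ ≤ S.a) (hδ0 : 0 ≤ δ) (hδ0' : 0 ≤ δ')
    (hδ : ∀ z ∈ S.trunc s, ‖z / (z - S.a) - q z‖ ≤ δ)
    (hδ' : ∀ z ∈ S.trunc s, ‖z‖ ≤ 3 / 2 * ρ → ‖q z‖ ≤ δ') :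
    ‖pairing S.a‖ ≤ (δ + 3 * ρ / S.a) *
      (Real.pi * 2 ^ 2 * C₀ + 4 * Real.pi * Cb * S.total) +
      δ' * (Real.pi * 2 ^ 2 * (Real.exp ((ρ ^ 2)⁻¹) * (Cb / ρ))) := by
  have ha := S.a_pos
  have ha' := S.a_le
  set ψ := S.cutoff s with hψ
  -- Cauchy's theorem cannot be applied across the essential singularity at `0`, so the cutoff is
  -- also made to vanish near `0`; the cost is a term with `dbar η`, controlled by the smallness of
  -- `q` there.
  set η : ℂ → ℂ := fun z => 1 - discBump 0 ρ z with hη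
  set ω : ℂ → ℂ := fun z => η z * ψ z with hω
  have hηd : Differentiable ℝ η := (differentiable_discBump 0 ρ).const_sub 1
  have hω0 : ∀ z, ‖z‖ ≤ ρ → ω z = 0 := by
    intro z hz
    simp only [hω, hη]
    rw [discBump_eq_one hρ (by simpa using hz)]; ring
  have hωC : ContDiff ℝ 1 ω := by
    rw [contDiff_iff_contDiffAt]
    intro z
    rcases eq_or_ne z 0 with rfl | hz
    · refine (contDiffAt_const (c := (0 : ℂ))).congr_of_eventuallyEq ?_
      filter_upwards [Metric.ball_mem_nhds (0 : ℂ) hρ] with z hz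
      exact hω0 z (mem_ball_zero_iff.1 hz).le
    · exact (contDiffAt_const.sub (contDiff_discBump 0 ρ).contDiffAt).mul
        (S.contDiffAt_cutoff s hz)
  have hωs : tsupport ω ⊆ S.trunc s ∩ {z | ρ ≤ ‖z‖} := by
    refine closure_minimal (fun z hz => ⟨?_, ?_⟩)
      ((S.isClosed_trunc s).inter (isClosed_le continuous_const continuous_norm))
    · exact S.mem_trunc_of_cutoff_ne_zero (right_ne_zero_of_mul hz)
    · by_contra h
      exact hz (hω0 z (not_le.1 h).le)
  have hωc : HasCompactSupport ω :=
    isCompact_closedSector.of_isClosed_subset (isClosed_tsupport ω)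
      fun z hz => (hωs hz).1.1
  have hV : IsOpen (U ∩ {0}ᶜ) := hU.inter isOpen_compl_singleton
  have hωV : tsupport ω ⊆ U ∩ {0}ᶜ := by
    intro z hz
    refine ⟨hsU (hωs hz).1, ?_⟩
    rintro rfl
    have : ρ ≤ ‖(0 : ℂ)‖ := (hωs hz).2
    rw [norm_zero] at this
    linarith
  have hqG : DifferentiableOn ℂ (fun z => q z * expInvSq z) (U ∩ {0}ᶜ) :=
    (hq.mono Set.inter_subset_left).mul fun z hz =>
      (differentiableAt_expInvSq hz.2).differentiableWithinAt
  have h0 := integral_mul_dbar_eq_zero hV hqG hωC hωc hωV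
  have h0i := integrable_mul_dbar hV hqG.continuousOn hωC hωc hωV
  obtain ⟨hXi, hX⟩ := S.integral_mul_dbar_cutoff hs
  have hX' : pairing S.a = ∫ z : ℂ, (z / (z - S.a) * expInvSq z * dbar ψ z -
      q z * expInvSq z * dbar ω z) := by
    rw [integral_sub hXi h0i, h0, hX, sub_zero]
  set T : ℝ := Real.exp ((ρ ^ 2)⁻¹) * (Cb / ρ) with hT
  have hT0 : 0 ≤ T := by positivity
  have hMi := S.integrable_majorant C₀ Cb s
  have hBi := integrable_indicator_closedBall 0 2 T
  have hbound : ‖pairing S.a‖ ≤ ∫ z, ((δ + 3 * ρ / S.a) * S.majorant C₀ Cb s z +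
      δ' * (Metric.closedBall (0 : ℂ) 2).indicator (fun _ => T) z) := by
    rw [hX']
    refine norm_integral_le_of_norm_le ((hMi.const_mul _).add (hBi.const_mul _)) ?_
    filter_upwards [ae_ne_zero] with z hz
    have e1 : dbar ω z = η z * dbar ψ z + ψ z * dbar η z :=
      dbar_mul (hηd z) (S.differentiableAt_cutoff s hz)
    have e2 : dbar η z = - dbar (discBump 0 ρ) z := dbar_const_sub _ _ _
    -- The three resulting terms are the approximation error `δ`, the smallness of `z / (z - a)`
    -- near `0` (giving `3 * ρ / a`), and `q` against the gradient of the small bump (giving the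
    -- `δ'` term).
    have e3 : z / (z - S.a) * expInvSq z * dbar ψ z - q z * expInvSq z * dbar ω z =
        (η z * (z / (z - S.a) - q z) + discBump 0 ρ z * (z / (z - S.a))) *
          (expInvSq z * dbar ψ z) + ψ z * q z * (expInvSq z * dbar (discBump 0 ρ) z) := by
      rw [e1, e2]
      simp only [hη]
      ring
    rw [e3]
    refine (norm_add_le _ _).trans (add_le_add ?_ ?_)
    · by_cases hd : dbar ψ z = 0
      · rw [hd, mul_zero, mul_zero, norm_zero]
        have h1 := S.norm_mul_dbar_cutoff_le hC₀ hCb s hz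
        have h2 := (norm_nonneg _).trans h1
        positivity
      have hzs : z ∈ S.trunc s := by
        by_contra h
        exact hd (dbar_eq_zero_of_notMem_tsupport fun h' => h (S.tsupport_cutoff_subset s h'))
      rw [norm_mul]
      refine mul_le_mul ?_ (S.norm_mul_dbar_cutoff_le hC₀ hCb s hz) (norm_nonneg _)
        (by positivity)
      refine (norm_add_le _ _).trans (add_le_add ?_ ?_)
      · rw [norm_mul]
        exact (mul_le_of_le_one_left (norm_nonneg _) (norm_one_sub_discBump_le_one _ _ _)).trans
          (hδ z hzs)
      · rcases le_total (3 / 2 * ρ) ‖z‖ with h | h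
        · rw [discBump_eq_zero hρ (by simpa using h), zero_mul, norm_zero]; positivity
        · rw [norm_mul]
          refine (mul_le_of_le_one_left (norm_nonneg _) (norm_discBump_le_one _ _ _)).trans ?_
          have h1 := norm_sub_norm_le (S.a : ℂ) z
          rw [norm_real, Real.norm_of_nonneg ha.le, norm_sub_rev] at h1
          have h2 : S.a / 2 ≤ ‖z - S.a‖ := by linarith
          rw [norm_div]
          calc ‖z‖ / ‖z - S.a‖ ≤ (3 / 2 * ρ) / (S.a / 2) := by gcongr
            _ = 3 * ρ / S.a := by field_simp
    · by_cases hd : dbar (discBump 0 ρ) z = 0 ∨ ψ z = 0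
      · have : ψ z * q z * (expInvSq z * dbar (discBump 0 ρ) z) = 0 := by
          rcases hd with h | h <;> rw [h] <;> ring
        rw [this, norm_zero]
        exact mul_nonneg hδ0' (Set.indicator_nonneg (fun _ _ => hT0) z)
      push Not at hd
      have hzs : z ∈ S.trunc s := S.mem_trunc_of_cutoff_ne_zero hd.2
      have hz1 : ρ ≤ ‖z‖ ∧ ‖z‖ ≤ 3 / 2 * ρ := by
        by_contra! h
        refine hd.1 (dbar_discBump_eq_zero hρ ?_)
        rw [sub_zero]
        rcases le_total ‖z‖ ρ with h' | h'
        · exact Or.inl h'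
        · exact Or.inr (h h').le
      rw [Set.indicator_of_mem (mem_closedBall_zero_iff.2 (by linarith)), norm_mul, norm_mul,
        norm_mul]
      gcongr
      · exact (mul_le_of_le_one_left (norm_nonneg _) (S.norm_cutoff_le_one s z)).trans
          (hδ' z hzs hz1.2)
      refine mul_le_mul (norm_expInvSq_le_of_le hρ hz1.1) ?_ (norm_nonneg _) (by positivity)
      rw [dbar_discBump, norm_div, norm_real, Real.norm_of_nonneg hρ.le]
      gcongr
      exact hCb _
  rw [integral_add (hMi.const_mul _) (hBi.const_mul _), integral_const_mul, integral_const_mul,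
    integral_indicator_closedBall _ (by norm_num)] at hbound
  refine hbound.trans (add_le_add_left ?_ _)
  exact mul_le_mul_of_nonneg_left (S.integral_majorant_le hCb0 s) (by positivity)

end DiscSystem

/-! ### The Swiss cheese: a peak point without strong regularity -/

namespace DiscSystem

variable (S : DiscSystem)

/-- The compact set that remains when all the discs are removed. -/
def cheese : TopologicalSpace.Compacts ℂ where
  carrier := closedSector \ ⋃ i, Metric.ball (S.ctr i) (S.rad i)
  isCompact' := isCompact_closedSector.diff (isOpen_iUnion fun _ => Metric.isOpen_ball)

lemma mem_cheese {z : ℂ} :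
    z ∈ S.cheese ↔ z ∈ closedSector ∧ ∀ i, z ∉ Metric.ball (S.ctr i) (S.rad i) := by
  change z ∈ closedSector \ ⋃ i, Metric.ball (S.ctr i) (S.rad i) ↔ _
  simp only [Set.mem_sdiff, Set.mem_iUnion, not_exists]

lemma zero_mem_cheese : (0 : ℂ) ∈ S.cheese := by
  refine S.mem_cheese.2 ⟨⟨by norm_num, by simp⟩, fun i => ?_⟩
  rw [mem_ball_iff_norm, zero_sub, norm_neg, not_lt]
  linarith [S.rad_pos i, S.two_mul_rad_lt i]

lemma sub_a_ne_zero {z : ℂ} (hz : z ∈ S.cheese) : z - S.a ≠ 0 := by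
  intro h
  refine (S.mem_cheese.1 hz).2 S.i₀ ?_
  rw [mem_ball_iff_norm, S.ctr_i₀, h, norm_zero]
  exact S.rad_pos _

/-- An open set that contains the cheese contains one of the sets `trunc s`. -/
lemma exists_trunc_subset {V : Set ℂ} (hV : IsOpen V) (h : (S.cheese : Set ℂ) ⊆ V) :
    ∃ s : Finset S.ι, S.i₀ ∈ s ∧ S.trunc s ⊆ V := by
  classical
  obtain ⟨t, ht⟩ := (isCompact_closedSector.diff hV).elim_finite_subcover
    (fun i => Metric.ball (S.ctr i) (S.rad i)) (fun _ => Metric.isOpen_ball) (by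
      rintro z ⟨hz, hzV⟩
      by_contra hn
      rw [Set.mem_iUnion, not_exists] at hn
      exact hzV (h (S.mem_cheese.2 ⟨hz, hn⟩)))
  refine ⟨insert S.i₀ t, Finset.mem_insert_self _ _, ?_⟩
  rintro z ⟨hz, hzs⟩
  by_contra hzV
  obtain ⟨i, hi, hzi⟩ := Set.mem_iUnion₂.1 (ht ⟨hz, hzV⟩)
  exact hzs (Set.mem_iUnion₂.2 ⟨i, Finset.mem_insert_of_mem hi, hzi⟩)

/-- The origin, as a point of the cheese. -/
def origin : S.cheese := ⟨0, S.zero_mem_cheese⟩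

/-- On the sector `‖1 - z / 10‖² ≤ 1 - ‖z‖ (2 - ‖z‖) / 100`, which is less than `1` for `0 < ‖z‖ ≤ 3
/ 2`. -/
lemma isPeakPoint_origin : IsPeakPoint (R S.cheese) S.origin := by
  refine ⟨1 - (1 / 10 : ℂ) • coord S.cheese, sub_mem (one_mem _)
    (Subalgebra.smul_mem _ (coord_mem _) _), ?_, fun z hz => ?_⟩
  · simp [coord, origin]
  · have h0 : (z : ℂ) ≠ 0 := fun h => hz (Subtype.ext h)
    have hp : 0 < ‖(z : ℂ)‖ := norm_pos_iff.2 h0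
    obtain ⟨h1, h2⟩ := (S.mem_cheese.1 z.2).1
    have e : ((1 : C(S.cheese, ℂ)) - (1 / 10 : ℂ) • coord S.cheese) z =
        1 - (1 / 10 : ℂ) * (z : ℂ) := rfl
    have e2 : ‖1 - (1 / 10 : ℂ) * (z : ℂ)‖ ^ 2 =
        1 - (z : ℂ).re / 5 + ‖(z : ℂ)‖ ^ 2 / 100 := by
      rw [← normSq_eq_norm_sq, ← normSq_eq_norm_sq, normSq_apply, normSq_apply]
      simp
      ring
    rw [e]
    refine (abs_lt_of_sq_lt_sq' ?_ zero_le_one).2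
    rw [e2]
    nlinarith

lemma total_nonneg : 0 ≤ S.total := by simpa using S.sum_le_total ∅

/-- If `z / (z - a)` were approximable by functions vanishing near the origin, `norm_pairing_le`
would bound `L = ‖pairing a‖` by `L / 4 + L / 8 + L / 4`. -/
lemma not_isStronglyRegularAt_origin (hS : pairing S.a ≠ 0) :
    ¬ IsStronglyRegularAt (R S.cheese) S.origin := by
  intro hreg
  obtain ⟨C₀, hC₀p, hC₀⟩ := exists_bound_dbar_baseCutoff
  obtain ⟨Cb, hCbp, hCb⟩ := exists_bound_dbar_bump
  have ha := S.a_pos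
  set L := ‖pairing S.a‖ with hL
  have hLp : 0 < L := norm_pos_iff.2 hS
  set M := Real.pi * 2 ^ 2 * C₀ + 4 * Real.pi * Cb * S.total with hM
  have hMp : 0 < M := by
    have := S.total_nonneg
    have := Real.pi_pos
    positivity
  obtain ⟨g, hg, hgz⟩ := mem_ratFunctions_of_eval (K := S.cheese) X (X - C (S.a : ℂ))
    fun z hz => by simpa using S.sub_a_ne_zero hz
  simp only [eval_X, eval_sub, eval_C] at hgz
  set δ := L / (8 * M) with hδ
  have hδp : 0 < δ := by positivity
  have hgM : (⟨g, ratFunctions_le_R _ hg⟩ : R S.cheese) ∈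
      closure (idealJ (R S.cheese) S.origin : Set (R S.cheese)) := by
    rw [hreg]
    change g S.origin = 0
    rw [hgz]; simp [origin]
  obtain ⟨f, hfJ, hfg⟩ := Metric.mem_closure_iff.1 hgM δ hδp
  obtain ⟨ρ₀, hρ₀, hfρ⟩ := Metric.mem_nhds_iff.1
    (show {y | (f : C(S.cheese, ℂ)) y = 0} ∈ 𝓝 S.origin from hfJ)
  -- The order of choices matters: `δ` fixes `f`, the zero neighbourhood of `f` limits `ρ`, and only
  -- then is the rational approximation made with a tolerance `δ'` that beats the factor `exp (1 /
  -- ρ²) / ρ` in `T`.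
  set ρ := min (min (S.a / 3) (ρ₀ / 2)) (S.a * L / (24 * M)) with hρ
  have hρp : 0 < ρ := by positivity
  have hρ1 : ρ ≤ S.a / 3 := (min_le_left _ _).trans (min_le_left _ _)
  have hρ2 : ρ ≤ ρ₀ / 2 := (min_le_left _ _).trans (min_le_right _ _)
  have hρ3 : 3 * ρ / S.a * M ≤ L / 8 := by
    have : ρ ≤ S.a * L / (24 * M) := min_le_right _ _
    calc _ ≤ 3 * (S.a * L / (24 * M)) / S.a * M := by gcongr
      _ = L / 8 := by field_simp; norm_num
  set T := Real.pi * 2 ^ 2 * (Real.exp ((ρ ^ 2)⁻¹) * (Cb / ρ)) with hT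
  have hTp : 0 < T := by
    have := Real.pi_pos
    positivity
  set δ' := min δ (L / (4 * T)) with hδ'
  have hδ'p : 0 < δ' := by positivity
  obtain ⟨h, hh, hfh⟩ := Metric.mem_closure_iff.1
    (show (f : C(S.cheese, ℂ)) ∈ closure (ratFunctions S.cheese : Set C(S.cheese, ℂ)) from f.2)
    δ' hδ'p
  obtain ⟨p, q, hq, hpq⟩ := hh
  set Q : ℂ → ℂ := fun z => p.eval z / q.eval z with hQ
  have hfhz : ∀ z : S.cheese, ‖(f : C(S.cheese, ℂ)) z - Q z‖ < δ' := by
    intro z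
    have := (ContinuousMap.dist_apply_le_dist (f := (f : C(S.cheese, ℂ))) (g := h) z).trans_lt hfh
    rwa [dist_eq_norm, hpq] at this
  have hfgz : ∀ z : S.cheese, ‖(z : ℂ) / (z - S.a) - (f : C(S.cheese, ℂ)) z‖ < δ := by
    intro z
    have := (ContinuousMap.dist_apply_le_dist (f := g) (g := (f : C(S.cheese, ℂ))) z).trans_lt hfg
    rwa [dist_eq_norm, hgz] at this
  set U : Set ℂ := {z | q.eval z ≠ 0} ∩ {z | z ≠ S.a} with hU
  have hUo : IsOpen U := (isOpen_ne_fun q.continuous continuous_const).inter isOpen_ne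
  have hQd : DifferentiableOn ℂ Q U := fun z hz =>
    (p.differentiable.differentiableAt.div q.differentiable.differentiableAt
      hz.1).differentiableWithinAt
  have hGc : ContinuousOn (fun z : ℂ => ‖z / (z - S.a) - Q z‖) U :=
    ((continuousOn_id.div (continuousOn_id.sub continuousOn_const)
      fun z hz => sub_ne_zero.2 hz.2).sub hQd.continuousOn).norm
  -- The estimates for the rational approximant hold on the cheese only. As strict inequalities they
  -- persist on an open neighbourhood, and by compactness this contains the sector with only
  -- finitely many discs removed.
  have hV1 := hGc.isOpen_inter_preimage hUo (isOpen_Iio (a := 2 * δ))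
  have hV2 := (hQd.continuousOn.norm).isOpen_inter_preimage hUo (isOpen_Iio (a := δ'))
  have hV3 : IsOpen {z : ℂ | 3 / 2 * ρ < ‖z‖} := isOpen_lt continuous_const continuous_norm
  obtain ⟨s, hs, hsV⟩ := S.exists_trunc_subset (hV1.inter (hV2.union hV3)) (by
    intro z hz
    have hzU : z ∈ U := ⟨hq z hz, sub_ne_zero.1 (S.sub_a_ne_zero hz)⟩
    have h1 := hfhz ⟨z, hz⟩
    have h2 := hfgz ⟨z, hz⟩
    refine ⟨⟨hzU, ?_⟩, ?_⟩
    · change ‖z / (z - S.a) - Q z‖ < 2 * δ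
      have h3 := norm_add_le (z / (z - S.a) - (f : C(S.cheese, ℂ)) ⟨z, hz⟩)
        ((f : C(S.cheese, ℂ)) ⟨z, hz⟩ - Q z)
      rw [sub_add_sub_cancel] at h3
      have h4 : δ' ≤ δ := min_le_left _ _
      linarith
    · rcases lt_or_ge (3 / 2 * ρ) ‖z‖ with hzρ | hzρ
      · exact Or.inr hzρ
      · refine Or.inl ⟨hzU, ?_⟩
        have h3 : (f : C(S.cheese, ℂ)) ⟨z, hz⟩ = 0 := by
          refine hfρ (?_ : dist (⟨z, hz⟩ : S.cheese) S.origin < ρ₀)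
          change dist z 0 < ρ₀
          rw [dist_zero_right]; linarith
        rw [h3, zero_sub, norm_neg] at h1
        exact h1)
  have key := S.norm_pairing_le hCbp.le hC₀ hCb hs hUo hQd (fun z hz => (hsV hz).1.1) hρp
    (by linarith) (by positivity : 0 ≤ 2 * δ) hδ'p.le (fun z hz => le_of_lt (hsV hz).1.2)
    (fun z hz hzρ => by
      rcases (hsV hz).2 with h2 | h2
      · exact le_of_lt h2.2
      · exact absurd h2 (not_lt.2 hzρ))
  rw [← hL, ← hM, ← hT] at key
  have k1 : 2 * δ * M = L / 4 := by rw [hδ]; field_simp; norm_num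
  have k2 : δ' * T ≤ L / 4 := by
    have : δ' ≤ L / (4 * T) := min_le_right _ _
    calc _ ≤ L / (4 * T) * T := by gcongr
      _ = L / 4 := by field_simp
  rw [add_mul] at key
  linarith

end DiscSystem

/-! ### Choice of the discs and conclusion -/

/-- The discs that make room for functions supported on small discs with centres at the origin and
in a dense sequence. -/
def IsBaseDisc (c : ℂ) (r : ℝ) : Prop :=
  (∃ n : ℕ, r = 1 / (n + 1)) ∧ (c = 0 ∨ c ∈ Set.range (TopologicalSpace.denseSeq ℂ) ∧ 4 * r < ‖c‖)

lemma IsBaseDisc.pos {c : ℂ} {r : ℝ} (h : IsBaseDisc c r) : 0 < r := by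
  obtain ⟨⟨n, rfl⟩, -⟩ := h
  positivity

lemma countable_isBaseDisc : {p : ℂ × ℝ | IsBaseDisc p.1 p.2}.Countable := by
  refine (((Set.countable_range (TopologicalSpace.denseSeq ℂ)).insert 0).prod
    (Set.countable_range fun n : ℕ => (1 / ((n : ℝ) + 1)))).mono ?_
  rintro ⟨c, r⟩ ⟨⟨n, hn⟩, hc⟩
  exact ⟨hc.imp id fun h => h.1, n, hn.symm⟩

/-- One McKissick family is removed for each of countably many base discs. None of their annuli
comes near `0`: they are either centred at `0` or contained in a disc far from it. So `expInvSq` is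
bounded on each family, and the total radius of the family can be taken small relative to that
bound. -/
lemma exists_discSystem : ∃ S : DiscSystem, pairing S.a ≠ 0 ∧
    ∀ c r, IsBaseDisc c r → ∃ f ∈ R S.cheese, (∀ z : S.cheese, r ≤ ‖(z : ℂ) - c‖ → f z = 0) ∧
      ∀ z : S.cheese, ‖(z : ℂ) - c‖ ≤ r / 2 → f z ≠ 0 := by
  obtain ⟨a, ha, ha', hpair⟩ := exists_pairing_ne_zero
  let B := {p : ℂ × ℝ // IsBaseDisc p.1 p.2}
  have hB : Countable B := countable_isBaseDisc.to_subtype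
  obtain ⟨e, he0, he⟩ := ENNReal.exists_pos_sum_of_countable one_ne_zero B
  -- A removed disc has its centre at distance more than `r / 2` from `0` and radius at most `r /
  -- 16`, so even its double stays outside `‖z‖ < r / 4`.
  let W : B → ℝ := fun b => Real.exp (((b.1.2 / 4) ^ 2)⁻¹)
  have hW : ∀ b, 0 < W b := fun b => Real.exp_pos _
  let ε : B → ℝ := fun b => min (b.1.2 / 16) (e b / W b)
  have hε : ∀ b, 0 < ε b := fun b => lt_min (by have := b.2.pos; positivity)
    (div_pos (NNReal.coe_pos.2 (he0 b)) (hW b))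
  choose ι ctr rad hpos hann hsum hK using fun b : B =>
    exists_mckissick_discs b.1.1 b.2.pos (hε b)
  have hrad : ∀ b i, rad b i ≤ b.1.2 / 16 := fun b i => by
    refine le_trans ?_ (min_le_left _ (e b / W b))
    exact (ENNReal.ofReal_le_ofReal_iff (hε b).le).1 ((ENNReal.le_tsum i).trans (hsum b))
  have hctr : ∀ b i, b.1.2 / 2 < ‖ctr b i‖ := by
    intro b i
    obtain ⟨h1, h2⟩ := hann b i
    have hb := b.2.pos
    rcases b.2.2 with h | ⟨-, h⟩
    · rwa [h, sub_zero] at h1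
    · have := norm_sub_norm_le b.1.1 (ctr b i)
      rw [norm_sub_rev] at this
      linarith
  let rad' : Option (Σ b, ι b) → ℝ := fun o => o.elim (a / 8) fun i => rad i.1 i.2
  let wt' : Option (Σ b, ι b) → ℝ := fun o => o.elim (Real.exp (((a / 2) ^ 2)⁻¹)) fun i => W i.1
  have htot : ∀ s : Finset (Σ b, ι b), ∑ i ∈ s, rad i.1 i.2 * W i.1 ≤ 1 := by
    intro s
    have h0 : ∀ i : Σ b, ι b, 0 ≤ rad i.1 i.2 * W i.1 := fun i =>
      mul_nonneg (hpos _ _).le (hW _).le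
    rw [← ENNReal.ofReal_le_ofReal_iff zero_le_one, ENNReal.ofReal_sum_of_nonneg fun i _ => h0 i]
    refine (ENNReal.sum_le_tsum s).trans ?_
    rw [ENNReal.tsum_sigma', ENNReal.ofReal_one]
    refine le_trans (ENNReal.tsum_le_tsum fun b => ?_) he.le
    simp_rw [ENNReal.ofReal_mul (hpos b _).le]
    rw [ENNReal.tsum_mul_right]
    calc _ ≤ ENNReal.ofReal (ε b) * ENNReal.ofReal (W b) := by gcongr; exact hsum b
      _ = ENNReal.ofReal (ε b * W b) := (ENNReal.ofReal_mul (hε b).le).symm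
      _ ≤ ENNReal.ofReal (e b) := by
        refine ENNReal.ofReal_le_ofReal ?_
        have : ε b ≤ e b / W b := min_le_right _ _
        rwa [le_div_iff₀ (hW b)] at this
      _ = e b := ENNReal.ofReal_coe_nnreal
  let S : DiscSystem :=
    { ι := Option (Σ b, ι b)
      ctr := fun o => o.elim (a : ℂ) fun i => ctr i.1 i.2
      rad := rad'
      wt := wt'
      rad_pos := by
        rintro (_ | i)
        · change 0 < a / 8; positivity
        · exact hpos _ _
      two_mul_rad_lt := by
        rintro (_ | i)
        · change 2 * (a / 8) < ‖(a : ℂ)‖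
          rw [norm_real, Real.norm_of_nonneg ha.le]; linarith
        · have h1 := hrad i.1 i.2
          have h2 := hctr i.1 i.2
          have h3 := i.1.2.pos
          change 2 * rad i.1 i.2 < ‖ctr i.1 i.2‖
          linarith
      norm_le_wt := by
        rintro (_ | i) z hz
        · change ‖z - a‖ ≤ 2 * (a / 8) at hz
          refine norm_expInvSq_le_of_le (by positivity) ?_
          have := norm_sub_norm_le (a : ℂ) z
          rw [norm_real, Real.norm_of_nonneg ha.le, norm_sub_rev] at this
          linarith
        · have h1 := hrad i.1 i.2
          have h2 := hctr i.1 i.2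
          have h3 := i.1.2.pos
          change ‖z - ctr i.1 i.2‖ ≤ 2 * rad i.1 i.2 at hz
          refine norm_expInvSq_le_of_le (by positivity) ?_
          have := norm_sub_norm_le (ctr i.1 i.2) z
          rw [norm_sub_rev] at this
          linarith
      total := rad' none * wt' none + 1
      sum_le_total := by
        intro s
        have h0 : ∀ o, 0 ≤ rad' o * wt' o := by
          rintro (_ | i)
          · exact mul_nonneg (by change 0 ≤ a / 8; positivity) (Real.exp_pos _).le
          · exact mul_nonneg (hpos _ _).le (hW _).le
        classical
        calc _ ≤ ∑ o ∈ Finset.insertNone (Finset.eraseNone s), rad' o * wt' o := by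
              refine Finset.sum_le_sum_of_subset_of_nonneg (fun o ho => ?_) fun o _ _ => h0 o
              rcases o with _ | i
              · simp
              · simpa using ho
          _ = rad' none * wt' none + ∑ i ∈ Finset.eraseNone s, rad i.1 i.2 * W i.1 :=
              Finset.sum_insertNone _ _
          _ ≤ _ := by gcongr; exact htot _
      a := a
      a_pos := ha
      a_le := ha'
      i₀ := none
      ctr_i₀ := rfl
      rad_i₀ := rfl }
  refine ⟨S, hpair, fun c r hcr => ?_⟩
  exact hK ⟨(c, r), hcr⟩ S.cheese fun i z hz => (S.mem_cheese.1 hz).2 (some ⟨_, i⟩)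

lemma exists_ne_zero_of_notMem {K : TopologicalSpace.Compacts ℂ}
    (hK : ∀ c r, IsBaseDisc c r → ∃ f ∈ R K, (∀ z : K, r ≤ ‖(z : ℂ) - c‖ → f z = 0) ∧
      ∀ z : K, ‖(z : ℂ) - c‖ ≤ r / 2 → f z ≠ 0)
    (x : K) (F : Set K) (hF : IsClosed F) (hx : x ∉ F) :
    ∃ f ∈ R K, f x ≠ 0 ∧ ∀ y ∈ F, f y = 0 := by
  obtain ⟨ε, hε, hball⟩ := Metric.isOpen_iff.1 hF.isOpen_compl x hx
  have hfar : ∀ y ∈ F, ε ≤ ‖(y : ℂ) - x‖ := by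
    intro y hy
    by_contra! h
    refine hball (?_ : dist (y : ℂ) x < ε) hy
    rwa [dist_eq_norm]
  rcases eq_or_ne (x : ℂ) 0 with h0 | h0
  · obtain ⟨n, hn⟩ := exists_nat_one_div_lt hε
    obtain ⟨f, hf, hf0, hf1⟩ := hK 0 (1 / (n + 1)) ⟨⟨n, rfl⟩, Or.inl rfl⟩
    refine ⟨f, hf, hf1 x (by rw [h0, sub_zero, norm_zero]; positivity), fun y hy => hf0 y ?_⟩
    have := hfar y hy
    rw [h0] at this
    linarith
  · have hx0 : 0 < ‖(x : ℂ)‖ := norm_pos_iff.2 h0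
    -- With a centre within `r / 2` of `x`, the bound `r < ε / 2` makes the function vanish on `F`,
    -- and `r < ‖x‖ / 8` ensures `4 * r < ‖c‖`.
    obtain ⟨n, hn⟩ := exists_nat_one_div_lt (show 0 < min (ε / 2) (‖(x : ℂ)‖ / 8) by positivity)
    set r : ℝ := 1 / (n + 1) with hr
    have hr0 : 0 < r := by positivity
    have hn1 := hn.trans_le (min_le_left _ _)
    have hn2 := hn.trans_le (min_le_right _ _)
    obtain ⟨k, hk⟩ := (TopologicalSpace.denseRange_denseSeq ℂ).exists_dist_lt (x : ℂ) (half_pos hr0)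
    set c := TopologicalSpace.denseSeq ℂ k with hc
    rw [dist_eq_norm] at hk
    have h1 := norm_sub_norm_le (x : ℂ) c
    obtain ⟨f, hf, hf0, hf1⟩ := hK c r ⟨⟨n, rfl⟩, Or.inr ⟨⟨k, rfl⟩, by linarith⟩⟩
    refine ⟨f, hf, hf1 x hk.le, fun y hy => hf0 y ?_⟩
    have h2 := hfar y hy
    have h3 := norm_sub_le_norm_sub_add_norm_sub (y : ℂ) c x
    rw [norm_sub_rev c] at h3
    linarith

lemma exists_compacts_isNormal_not_isStronglyRegularAt : ∃ K : TopologicalSpace.Compacts ℂ,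
    IsUniformAlgebra (R K) ∧ IsNormal (R K) ∧
      ∃ x : K, IsPeakPoint (R K) x ∧ ¬ IsStronglyRegularAt (R K) x := by
  obtain ⟨S, hS, hK⟩ := exists_discSystem
  exact ⟨S.cheese, isUniformAlgebra_R _, ⟨isNatural_R _, isNormalOn_of_regular (isClosed_R _)
    (isNatural_R _) (exists_ne_zero_of_notMem hK)⟩, S.origin, S.isPeakPoint_origin,
    S.not_isStronglyRegularAt_origin hS⟩

end UniformAlgebra

theorem mainTheorem2 :
    (∃ (X : Type) (_ : TopologicalSpace X) (_ : CompactSpace X)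
        (_ : TopologicalSpace.MetrizableSpace X) (A : Subalgebra ℂ C(X, ℂ)),
      UniformAlgebra.IsUniformAlgebra A ∧ UniformAlgebra.IsNormal A ∧
        ∃ x : X, UniformAlgebra.IsPeakPoint A x ∧ ¬ UniformAlgebra.IsStronglyRegularAt A x) ∧
    (∃ K : TopologicalSpace.Compacts ℂ,
      UniformAlgebra.IsUniformAlgebra (UniformAlgebra.R K) ∧
        UniformAlgebra.IsNormal (UniformAlgebra.R K) ∧
        ∃ x : K, UniformAlgebra.IsPeakPoint (UniformAlgebra.R K) x ∧
          ¬ UniformAlgebra.IsStronglyRegularAt (UniformAlgebra.R K) x) := by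
  obtain ⟨K, hu, hn, hx⟩ := UniformAlgebra.exists_compacts_isNormal_not_isStronglyRegularAt
  exact ⟨⟨K, inferInstance, inferInstance, inferInstance, UniformAlgebra.R K, hu, hn, hx⟩,
    K, hu, hn, hx⟩
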